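/- **Setting.** For $n\ge 1$ let $J=(J_{jk})_{1\le j<k\le n}$ be independent standard normal variables and $C(z)=\frac1{\sqrt n}\sum_{j<k}J_{jk}z_jz_k$ for $z\in\{\pm1\}^n$ (the Sherrington–Kirkpatrick model), regarded also as a diagonal operator on $(\mathbb C^2)^{\otimes n}$. Let $B=\sum_j X_j$ be the sum of the Pauli $X$ operators, $|s\rangle=2^{-n/2}\sum_z|z\rangle$, and for $\gamma,\beta\in\mathbb R^p$ let $|\gamma,\beta\rangle=e^{-i\beta_pB}e^{-i\gamma_pC}\cdots e^{-i\beta_1B}e^{-i\gamma_1C}|s\rangle$ (the QAOA state). **Definitions.** Let $A=\{\pm1\}^{2p}$, with elements $a=(a_1,\dots,a_p,a_{-p},\dots,a_{-1})$ and entrywise product $ab$. Put $a^*_{r}=a_ra_{r+1}\cdots a_p$ and $a^*_{-r}=a_{-r}a_{-r-1}\cdots a_{-p}$ for $1\le r\le p$. Let $A_{p+1}=\{a: a_{-r}=a_r\text{ for all }r\}$ and $A_\ell=\{a: a_{-r}=a_r \text{ for } r>p-\ell+1,\ a_{-(p-\ell+1)}=-a_{p-\ell+1}\}$ for $1\le\ell\le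 p$; for $a\in A_\ell$, $\ell\le p$, let $\bar a$ be $a$ with the signs of $a_{\pm(p-\ell+1)}$ flipped. With $\theta(b)=(1+b)/2$ let $$Q_a=\prod_{j=1}^p(\cos\beta_j)^{\theta(a_j)+\theta(a_{-j})}(\sin\beta_j)^{\theta(-a_j)+\theta(-a_{-j})}\,i^{\,\theta(-a_j)-\theta(-a_{-j})},\qquad \Phi_a=\sum_{r=1}^p\gamma_r(a^*_r-a^*_{-r}),$$ $$F_b=\exp\Big[-\tfrac12\sum_{a\in A_{p+1}}Q_a\Phi_{ab}^2\Big],\qquad X_b=Q_bF_b,\qquad K_{b,c}=\tfrac12X_b(\Phi_{\bar bc}^2-\Phi_{bc}^2).$$ An *admissible indexing* is an enumeration $D=(d_1,\dots,d_{|D|})$ without repetition of a subset of $A\setminus A_{p+1}$ that contains exactly one of $b,\bar b$ for every $b\in A\setminus A_{p+1}$, such that $\Phi^2_{\bar d_id_j}=\Phi^2_{d_id_j}$ whenever $i\le j$. Given $D$, start with $R_j=1$ for all $1\le j\le |D|$; for $s=|D|,|D|-1,\dots,2$ replace $R_j$ by $R_j\exp(R_sK_{d_s,d_j})$ for all $j$;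 with the final values put $Y_u=\exp[\sum_jR_jK_{d_j,u}]$ and $W_u=X_uY_u$ for $u\in A$. Let $$V_p(\gamma,\beta)=\frac i2\sum_{r=1}^p\gamma_r\Big[\sum_{u\in A}(u^*_r+u^*_{-r})W_u\Big]\Big[\sum_{v\in A}(v^*_r-v^*_{-r})W_v\Big].$$ For $u,v,x,y\in A$ let, with sums over all $(n_a)_{a\in A}\in\mathbb Z_{\ge0}^A$ with $\sum_an_a=n$, $$S_{u,v}=\sum_{\{n_a\}}\binom n{\{n_a\}}\exp\Big[-\frac1{4n}\sum_{a,b\in A}\Phi_{ab}^2n_an_b\Big]\Big(\prod_{a\in A}Q_a^{n_a}\Big)\frac{n_un_v}{n^2},$$ and let $S_{u,v,x,y}$ be the same sum with $\frac{n_un_vn_xn_y}{n^4}$ in place of $\frac{n_un_v}{n^2}$. **Theorem.** For every $p$ there is an enumeration $D$ that is an admissible indexing for all $\gamma$. For every $p$, all $\gamma,\beta\in\mathbb R^p$ and every admissible indexing $D$: 1. $\lim_{n\to\infty}S_{u,v}=W_uW_v$ and $\lim_{n\to\infty}S_{u,v,x,y}=W_uW_vW_xW_y$ for all $u,v,x,y\in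 A$. 2. $\langle\gamma,\beta|C/n|\gamma,\beta\rangle$ is integrable in $J$, and $\lim_{n\to\infty}\mathbb E_J\langle\gamma,\beta|C/n|\gamma,\beta\rangle$ exists and equals $V_p(\gamma,\beta)$. 3. The procedure that, from the input $(\gamma,\beta)$, computes in this order $\cos\beta_r,\sin\beta_r$, all $Q_a$, all $\Phi_a^2$, all $X_b$, then the array $R$ by the iteration above (evaluating $K$ when it is needed), then $W_u=X_u$ for $u\in A_{p+1}$, $W_u=X_uY_u$ and $W_{\bar u}=-W_u$ for $u\in D$, and finally the formula for $V_p$, returns all $W_u$ and $V_p(\gamma,\beta)$ and uses at most $c\cdot16^p$ elementary operations (loading a rational constant or $i$, copying, negation, addition, subtraction, multiplication, $\exp$, $\cos$, $\sin$ of complex numbers), with an absolute constant $c$. -/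

import Mathlib

noncomputable section

namespace QAOASK

open MeasureTheory ProbabilityTheory Matrix

/-! ### The Sherrington-Kirkpatrick model and the QAOA -/

/-- Strings of `n` spins; a spin `±1` is an element of `ℤˣ`. -/
abbrev Spins (n : ℕ) := Fin n → ℤˣ

/-- The pairs `j < k`. -/
abbrev Pairs (n : ℕ) := {e : Fin n × Fin n // e.1 < e.2}

/-- `C(z) = n^{-1/2} ∑_{j<k} J_{jk} z_j z_k`. -/
def cost {n : ℕ} (J : Pairs n → ℝ) (z : Spins n) : ℝ :=
  (1 / Real.sqrt n) * ∑ e : Pairs n, J e * ((z e.1.1 : ℤ) : ℝ) * ((z e.1.2 : ℤ) : ℝ)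

/-- The operator `C`, diagonal in the computational basis. -/
def costOp {n : ℕ} (J : Pairs n → ℝ) : Matrix (Spins n) (Spins n) ℂ :=
  Matrix.diagonal fun z => (cost J z : ℂ)

/-- The Pauli operator `X_j`, which flips the spin `j`. -/
def pauliX {n : ℕ} (j : Fin n) : Matrix (Spins n) (Spins n) ℂ :=
  fun z z' => if z = Function.update z' j (-z' j) then 1 else 0

/-- `B = ∑_j X_j`. -/
def mixer (n : ℕ) : Matrix (Spins n) (Spins n) ℂ := ∑ j : Fin n, pauliX j

/-- `U(C,γ) = exp(-iγC)`. -/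
def phaseUnitary {n : ℕ} (J : Pairs n → ℝ) (γ : ℝ) : Matrix (Spins n) (Spins n) ℂ :=
  NormedSpace.exp ((-(Complex.I * (γ : ℂ))) • costOp J)

/-- `U(B,β) = exp(-iβB)`. -/
def mixerUnitary (n : ℕ) (β : ℝ) : Matrix (Spins n) (Spins n) ℂ :=
  NormedSpace.exp ((-(Complex.I * (β : ℂ))) • mixer n)

/-- The uniform superposition `|s⟩`. -/
def initialState (n : ℕ) : Spins n → ℂ := fun _ => ((1 / Real.sqrt (2 ^ n) : ℝ) : ℂ)

/-- `|γ,β⟩ = U(B,β_p) U(C,γ_p) ⋯ U(B,β_1) U(C,γ_1) |s⟩`. -/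
def qaoaState {n p : ℕ} (J : Pairs n → ℝ) (γ β : Fin p → ℝ) : Spins n → ℂ :=
  (List.finRange p).foldl
    (fun ψ r => mixerUnitary n (β r) *ᵥ (phaseUnitary J (γ r) *ᵥ ψ)) (initialState n)

/-- `⟨γ,β| C/n |γ,β⟩`. -/
def energyDensity {n p : ℕ} (γ β : Fin p → ℝ) (J : Pairs n → ℝ) : ℂ :=
  star (qaoaState J γ β) ⬝ᵥ (((1 / (n : ℂ)) • costOp J) *ᵥ qaoaState J γ β)

/-- The law of the couplings: independent standard normal variables. -/
def couplingLaw (n : ℕ) : Measure (Pairs n → ℝ) := Measure.pi fun _ => gaussianReal 0 1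

/-! ### Configurations -/

/-- The set `A` of configurations `(a_1,…,a_p,a_{-p},…,a_{-1})`. The entries `a_1,…,a_p` are
`a.1 0, …, a.1 (p-1)`, and `a_{-1},…,a_{-p}` are `a.2 0, …, a.2 (p-1)`. Multiplication is
entrywise. -/
abbrev Config (p : ℕ) := (Fin p → ℤˣ) × (Fin p → ℤˣ)

variable {p : ℕ}

/-- `a ∈ A_ℓ` with `1 ≤ ℓ ≤ p`, where `r` stands for the position `p - ℓ + 1` (counted from 1). -/
def HasPivot (a : Config p) (r : Fin p) : Prop :=
  a.2 r = -a.1 r ∧ ∀ s, r < s → a.2 s = a.1 s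

instance (a : Config p) (r : Fin p) : Decidable (HasPivot a r) := by
  unfold HasPivot; infer_instance

/-- `a ∈ A_{p+1}`. -/
def IsMirror (a : Config p) : Prop := ∀ r, a.2 r = a.1 r

instance (a : Config p) : Decidable (IsMirror a) := by
  unfold IsMirror; infer_instance

/-- The operation `a ↦ ā` (it fixes the elements of `A_{p+1}`, where it is never used). -/
def bar (a : Config p) : Config p :=
  (fun r => if HasPivot a r then -a.1 r else a.1 r,
   fun r => if HasPivot a r then -a.2 r else a.2 r)

/-- `a*_r = a_r a_{r+1} ⋯ a_p` and `a*_{-r} = a_{-r} a_{-r-1} ⋯ a_{-p}`. -/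
def starOp (a : Config p) : Config p :=
  (fun r => ∏ s ∈ Finset.Ici r, a.1 s, fun r => ∏ s ∈ Finset.Ici r, a.2 s)

/-- The integer `a*_r + a*_{-r}`. -/
def starSum (a : Config p) (r : Fin p) : ℤ := ((starOp a).1 r : ℤ) + ((starOp a).2 r : ℤ)

/-- The integer `a*_r - a*_{-r}`. -/
def starDiff (a : Config p) (r : Fin p) : ℤ := ((starOp a).1 r : ℤ) - ((starOp a).2 r : ℤ)

/-- `θ(b) = (1 + b) / 2`. -/
def theta (b : ℤˣ) : ℕ := if b = 1 then 1 else 0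

/-- `Φ_c = ∑_r γ_r (c*_r - c*_{-r})`. -/
def Phi (γ : Fin p → ℝ) (c : Config p) : ℝ := ∑ r, γ r * (starDiff c r : ℝ)

/-- `Q_a = ∏_j (cos β_j)^{θ(a_j)+θ(a_{-j})} (sin β_j)^{θ(-a_j)+θ(-a_{-j})}
i^{θ(-a_j)-θ(-a_{-j})}`. -/
def Q (β : Fin p → ℝ) (a : Config p) : ℂ :=
  ∏ j, (Real.cos (β j) : ℂ) ^ (theta (a.1 j) + theta (a.2 j)) *
    (Real.sin (β j) : ℂ) ^ (theta (-a.1 j) + theta (-a.2 j)) *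
    Complex.I ^ ((theta (-a.1 j) : ℤ) - (theta (-a.2 j) : ℤ))

/-- `F_b = exp[-½ ∑_{a ∈ A_{p+1}} Q_a Φ_{ab}²]`. -/
def F (γ β : Fin p → ℝ) (b : Config p) : ℂ :=
  Complex.exp (-(1 / 2) * ∑ a : Config p with IsMirror a, Q β a * (Phi γ (a * b) : ℂ) ^ 2)

/-- `X_b = Q_b F_b`. -/
def X (γ β : Fin p → ℝ) (b : Config p) : ℂ := Q β b * F γ β b

/-- `K_{b,c} = ½ X_b (Φ_{b̄c}² - Φ_{bc}²)`. -/
def K (γ β : Fin p → ℝ) (b c : Config p) : ℂ :=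
  1 / 2 * X γ β b * ((Phi γ (bar b * c) : ℂ) ^ 2 - (Phi γ (b * c) : ℂ) ^ 2)

/-- `b` plays well with `c`. -/
def PlaysWell (γ : Fin p → ℝ) (b c : Config p) : Prop :=
  Phi γ (bar b * c) ^ 2 = Phi γ (b * c) ^ 2

/-- The list `D` has no repetitions and contains exactly one of `b`, `b̄` for every
`b ∈ B = A ∖ A_{p+1}`, and nothing else. The position of `b` in `D` is its index. -/
def IsHalf (D : List (Config p)) : Prop :=
  D.Nodup ∧ (∀ b ∈ D, ¬ IsMirror b) ∧ ∀ b, ¬ IsMirror b → (b ∈ D ↔ bar b ∉ D)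

/-- The indexing of `D` is admissible: an element plays well with those of larger index. -/
def IsIndexing (γ : Fin p → ℝ) (D : List (Config p)) : Prop :=
  IsHalf D ∧ D.Pairwise (PlaysWell γ)

/-- The array `R` at the end of the iteration: it starts as `R_j = 1`, and for
`s = |D|, …, 3, 2` every `R_j` is replaced by `R_j exp(R_s K_{s,j})`. -/
def R (γ β : Fin p → ℝ) (D : List (Config p)) : Config p → ℂ :=
  D.tail.reverse.foldl (fun R s j => R j * Complex.exp (R s * K γ β s j)) (fun _ => 1)

/-- `Y_u = exp[∑_{j ∈ D} R_j K_{j,u}]`. -/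
def Y (γ β : Fin p → ℝ) (D : List (Config p)) (u : Config p) : ℂ :=
  Complex.exp (D.map fun j => R γ β D j * K γ β j u).sum

/-- `W_u = X_u Y_u`. -/
def W (γ β : Fin p → ℝ) (D : List (Config p)) (u : Config p) : ℂ := X γ β u * Y γ β D u

/-- `(i/2) ∑_r γ_r [∑_u (u*_r + u*_{-r}) W_u] [∑_v (v*_r - v*_{-r}) W_v]`. -/
def V (γ β : Fin p → ℝ) (D : List (Config p)) : ℂ :=
  Complex.I / 2 * ∑ r, (γ r : ℂ) *
    (∑ u, (starSum u r : ℂ) * W γ β D u) * (∑ v, (starDiff v r : ℂ) * W γ β D v)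

/-! ### Sums in the configuration basis -/

/-- The weight of the occupation numbers `(n_a)`:
`binom(n; {n_a}) exp[-(1/4n) ∑_{a,b} Φ_{ab}² n_a n_b] ∏_a Q_a^{n_a}`. -/
def weight (γ β : Fin p → ℝ) (n : ℕ) (N : Config p → ℕ) : ℂ :=
  (Nat.multinomial Finset.univ N : ℂ) *
    ((Real.exp (-(1 / (4 * n)) * ∑ a, ∑ b, Phi γ (a * b) ^ 2 * N a * N b) : ℝ) : ℂ) *
    ∏ a, Q β a ^ N a

/-- `S_{u,v}`, a sum over all `(n_a)` with `∑_a n_a = n`. -/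
def S₂ (γ β : Fin p → ℝ) (u v : Config p) (n : ℕ) : ℂ :=
  ∑ N ∈ Finset.piAntidiag (Finset.univ : Finset (Config p)) n,
    weight γ β n N * ((N u : ℂ) * N v / (n : ℂ) ^ 2)

/-- `S_{u,v,x,y}`. -/
def S₄ (γ β : Fin p → ℝ) (u v x y : Config p) (n : ℕ) : ℂ :=
  ∑ N ∈ Finset.piAntidiag (Finset.univ : Finset (Config p)) n,
    weight γ β n N * ((N u : ℂ) * N v * N x * N y / (n : ℂ) ^ 4)

/-! ### The evaluation procedure with its operation count

The machine has registers that hold complex numbers. An instruction performs one elementary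
operation and costs one step. -/

/-- One elementary operation; the first argument is the register that is overwritten. -/
inductive Instr (ι : Type) where
  | rat (d : ι) (q : ℚ)
  | imag (d : ι)
  | copy (d x : ι)
  | neg (d x : ι)
  | add (d x y : ι)
  | sub (d x y : ι)
  | mul (d x y : ι)
  | exp (d x : ι)
  | cos (d x : ι)
  | sin (d x : ι)

/-- The effect of one instruction on the memory. -/
def Instr.run {ι : Type} [DecidableEq ι] (m : ι → ℂ) : Instr ι → ι → ℂ
  | .rat d q => Function.update m d (q : ℂ)
  | .imag d => Function.update m d Complex.I
  | .copy d x => Function.update m d (m x)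
  | .neg d x => Function.update m d (-m x)
  | .add d x y => Function.update m d (m x + m y)
  | .sub d x y => Function.update m d (m x - m y)
  | .mul d x y => Function.update m d (m x * m y)
  | .exp d x => Function.update m d (Complex.exp (m x))
  | .cos d x => Function.update m d (Complex.cos (m x))
  | .sin d x => Function.update m d (Complex.sin (m x))

/-- Run the instructions one after the other; the number of steps is the length of the list. -/
def exec {ι : Type} [DecidableEq ι] (prog : List (Instr ι)) (m : ι → ℂ) : ι → ℂ :=
  prog.foldl Instr.run m

/-- The registers: `gamma` and `beta` hold the input, `w` and `v` the output. -/
inductive Reg (p : ℕ) where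
  | gamma (r : Fin p)
  | beta (r : Fin p)
  | cosBeta (r : Fin p)
  | sinBeta (r : Fin p)
  | phiSq (c : Config p)
  | q (a : Config p)
  | x (b : Config p)
  | r (j : Config p)
  | w (u : Config p)
  | v
  | tmp
  | acc
  | acc'
deriving DecidableEq

open Instr Reg

/-- The configurations of `A`, in some order. -/
def allConfigs (p : ℕ) : List (Config p) := (Finset.univ : Finset (Config p)).toList

/-- The configurations of `A_{p+1}`, in some order. -/
def symmConfigs (p : ℕ) : List (Config p) := (allConfigs p).filter fun a => IsMirror a

/-- `cos β_r` and `sin β_r` for all `r`. -/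
def progTrig (p : ℕ) : List (Instr (Reg p)) :=
  (List.finRange p).flatMap fun r => [cos (cosBeta r) (beta r), sin (sinBeta r) (beta r)]

/-- `acc := acc * ⟨z|e^{iβB}|1⟩` for one spin `z = b` (or its complex conjugate). -/
def progFactor (r : Fin p) (b : ℤˣ) (conj : Bool) : List (Instr (Reg p)) :=
  if b = 1 then [mul acc acc (cosBeta r)]
  else [mul acc acc (sinBeta r), imag tmp] ++
    (if conj then [neg tmp tmp] else []) ++ [mul acc acc tmp]

/-- `Q_a` for all `a ∈ A`. -/
def progQ (p : ℕ) : List (Instr (Reg p)) :=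
  (allConfigs p).flatMap fun a =>
    [rat acc 1] ++
    ((List.finRange p).flatMap fun r =>
      progFactor r (a.1 r) false ++ progFactor r (a.2 r) true) ++
    [copy (q a) acc]

/-- `Φ_c²` for all `c ∈ A`. -/
def progPhi (p : ℕ) : List (Instr (Reg p)) :=
  (allConfigs p).flatMap fun c =>
    [rat acc 0] ++
    ((List.finRange p).flatMap fun r =>
      [rat tmp (starDiff c r), mul tmp (gamma r) tmp, add acc acc tmp]) ++
    [mul (phiSq c) acc acc]

/-- `X_b = Q_b F_b` for all `b ∈ A`. -/
def progX (p : ℕ) : List (Instr (Reg p)) :=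
  (allConfigs p).flatMap fun b =>
    [rat acc 0] ++
    ((symmConfigs p).flatMap fun a => [mul tmp (q a) (phiSq (a * b)), add acc acc tmp]) ++
    [rat tmp (-1 / 2), mul tmp tmp acc, exp tmp tmp, mul (x b) (q b) tmp]

/-- `tmp := R_b K_{b,c}`; the register `acc'` is overwritten. -/
def progRK (b c : Config p) : List (Instr (Reg p)) :=
  [sub tmp (phiSq (bar b * c)) (phiSq (b * c)), mul tmp (x b) tmp, rat acc' (1 / 2),
    mul tmp acc' tmp, mul tmp (r b) tmp]

/-- Initialize `R_j := 1`; then, for `s = |D|, …, 2`, update `R_j := R_j exp(R_s K_{s,j})` for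
every `j`. -/
def progR (D : List (Config p)) : List (Instr (Reg p)) :=
  (D.map fun j => rat (r j) 1) ++
  D.tail.reverse.flatMap fun s =>
    D.flatMap fun j => progRK s j ++ [exp tmp tmp, mul (r j) (r j) tmp]

/-- `W_u = X_u` for `u ∈ A_{p+1}`; `W_u = X_u Y_u` and `W_ū = -W_u` for `u ∈ D`. -/
def progW (D : List (Config p)) : List (Instr (Reg p)) :=
  ((symmConfigs p).map fun u => copy (w u) (x u)) ++
  D.flatMap fun u =>
    [rat acc 0] ++ (D.flatMap fun j => progRK j u ++ [add acc acc tmp]) ++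
    [exp tmp acc, mul (w u) (x u) tmp, neg (w (bar u)) (w u)]

/-- The value of the formula for `V_p`, from the `W_u`. -/
def progV (p : ℕ) : List (Instr (Reg p)) :=
  [rat v 0] ++
  ((List.finRange p).flatMap fun r =>
    [rat acc 0, rat acc' 0] ++
    ((allConfigs p).flatMap fun u =>
      [rat tmp (starSum u r), mul tmp tmp (w u), add acc acc tmp,
        rat tmp (starDiff u r), mul tmp tmp (w u), add acc' acc' tmp]) ++
    [mul tmp acc acc', mul tmp (gamma r) tmp, add v v tmp]) ++
  [rat tmp (1 / 2), mul v tmp v, imag tmp, mul v tmp v]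

/-- The whole procedure, from the parameters to the `W_u` and `V_p`. -/
def procedure (D : List (Config p)) : List (Instr (Reg p)) :=
  progTrig p ++ progQ p ++ progPhi p ++ progX p ++ progR D ++ progW D ++ progV p

end QAOASK

end

/-!
Expanding the unitaries in the computational basis assigns to every spin a pair of paths, that is, a
configuration `a ∈ A`. The couplings enter the phase linearly, so the Gaussian average depends only
on the occupation numbers `n_a`, and the energy becomes a combination of the sums `S_{u,v}`.

The terms of these multinomial sums are not small, but they cancel: `b` and `b̄` have opposite
weights `Q`, and exchanging one for the other changes the quadratic phase only by `O(1/n)` times the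
occupation numbers of the pairs of smaller index. Summing over the splittings of a fixed value of
`n_b + n_b̄` gives a power of that small difference, so only bounded occupation of the pairs
contributes, and the elements of `A_{p+1}`, whose weights form a probability distribution, fill up
the remaining places. As `n → ∞` a dominated series over the occupation numbers of the pairs
remains. In it the rate of a pair is affine in the occupation numbers of the pairs with smaller
index, so summing over the last pair gives an exponential that rescales the coefficients of all
other pairs. Iterating this is the recursion for `R`.

A factor `n_u` in a moment removes one element from the multinomial sum and adds it to a fixed
background, which changes the limit only by the factor `W_u`. Hence the moments factorize.
-/

noncomputable section

namespace QAOASK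

open MeasureTheory ProbabilityTheory Matrix Filter Topology

/-! ### Words and multinomial sums -/

section Words

variable {ι A B : Type*} [Fintype ι] [DecidableEq A]

/-- The occupation numbers of a word `f`: how often it takes each value. Sums over occupation
numbers weighted by multinomial coefficients are sums over words. -/
def valueCount (f : ι → A) (a : A) : ℕ := Finset.card {i | f i = a}

lemma prod_comp_eq_prod_pow_valueCount [Fintype A] {M : Type*} [CommMonoid M] (f : ι → A)
    (y : A → M) : ∏ i, y (f i) = ∏ a, y a ^ valueCount f a := by
  rw [← Finset.prod_fiberwise _ f]
  refine Finset.prod_congr rfl fun a _ => ?_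
  rw [valueCount, Finset.prod_congr rfl fun i hi => by rw [(Finset.mem_filter.1 hi).2],
    Finset.prod_const]

lemma sum_comp_eq_sum_valueCount_mul [Fintype A] {R : Type*} [Semiring R] (f : ι → A)
    (y : A → R) : ∑ i, y (f i) = ∑ a, valueCount f a * y a := by
  rw [← Finset.sum_fiberwise _ f]
  refine Finset.sum_congr rfl fun a _ => ?_
  rw [valueCount, Finset.sum_congr rfl fun i hi => by rw [(Finset.mem_filter.1 hi).2],
    Finset.sum_const, nsmul_eq_mul]

lemma sum_valueCount [Fintype A] (f : ι → A) : ∑ a, valueCount f a = Fintype.card ι := by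
  simpa using (sum_comp_eq_sum_valueCount_mul f fun _ => (1 : ℕ)).symm

lemma valueCount_mem_piAntidiag [Fintype A] (f : ι → A) :
    valueCount f ∈ Finset.univ.piAntidiag (Fintype.card ι) := by
  simp [sum_valueCount]

lemma card_valueCount_eq [Fintype A] [DecidableEq ι] {N : A → ℕ}
    (hN : ∑ a, N a = Fintype.card ι) :
    Finset.card {f : ι → A | valueCount f = N} = Nat.multinomial Finset.univ N := by
  have pow_eq : (∑ a, MvPolynomial.X a : MvPolynomial A ℕ) ^ Fintype.card ι =
      ∑ f : ι → A, MvPolynomial.monomial (Finsupp.equivFunOnFinite.symm (valueCount f)) 1 := by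
    rw [← Finset.card_univ, ← Finset.prod_const, Finset.prod_univ_sum, Fintype.piFinset_univ]
    refine Finset.sum_congr rfl fun f _ => ?_
    rw [MvPolynomial.monomial_eq, Finsupp.prod_fintype _ _ (by simp),
      prod_comp_eq_prod_pow_valueCount f (MvPolynomial.X (R := ℕ))]
    simp
  have coeff_eq := congrArg (MvPolynomial.coeff (Finsupp.equivFunOnFinite.symm N)) pow_eq
  rw [MvPolynomial.coeff_sum_X_pow_of_fintype, if_pos (by simpa [Finsupp.sum_fintype] using hN),
    Finsupp.multinomial_eq_of_support_subset (Finset.subset_univ _)] at coeff_eq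
  simpa [MvPolynomial.coeff_sum, MvPolynomial.coeff_monomial] using coeff_eq.symm

lemma sum_comp_valueCount [Fintype A] [DecidableEq ι] {M : Type*} [AddCommMonoid M]
    (G : (A → ℕ) → M) :
    ∑ f : ι → A, G (valueCount f) =
      ∑ N ∈ Finset.univ.piAntidiag (Fintype.card ι), Nat.multinomial Finset.univ N • G N := by
  rw [← Finset.sum_fiberwise_of_maps_to fun f _ => valueCount_mem_piAntidiag f]
  refine Finset.sum_congr rfl fun N hN => ?_
  rw [← card_valueCount_eq (Finset.mem_piAntidiag.1 hN).1, ← Finset.sum_const]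
  exact Finset.sum_congr rfl fun f hf => by rw [(Finset.mem_filter.1 hf).2]

/-- The occupation numbers of the fibres of `π`, that is, the occupation numbers of the word
`π ∘ f` in terms of those of `f`. -/
def fiberCount [Fintype A] [DecidableEq B] (π : A → B) (N : A → ℕ) (b : B) : ℕ :=
  ∑ a with π a = b, N a

lemma fiberCount_valueCount [Fintype A] [DecidableEq B] (π : A → B) (f : ι → A) :
    fiberCount π (valueCount f) = valueCount (π ∘ f) := by
  funext b
  simp only [fiberCount, valueCount, Finset.card_filter, Function.comp_apply]
  rw [Finset.sum_comm]
  refine Finset.sum_congr rfl fun i _ => ?_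
  simp [Finset.sum_ite_eq]

lemma sum_multinomial_fiberCount [Fintype A] [Fintype B] [DecidableEq B] {R : Type*}
    [CommSemiring R] (π : A → B) (y : (B → ℕ) → A → R) (n : ℕ) :
    ∑ N ∈ Finset.univ.piAntidiag n,
      (Nat.multinomial Finset.univ N : R) * ∏ a, y (fiberCount π N) a ^ N a =
    ∑ T ∈ Finset.univ.piAntidiag n,
      (Nat.multinomial Finset.univ T : R) * ∏ b, (∑ a with π a = b, y T a) ^ T b := by
  have words_A := sum_comp_valueCount (ι := Fin n) fun N : A → ℕ =>
    ∏ a, y (fiberCount π N) a ^ N a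
  have words_B := sum_comp_valueCount (ι := Fin n) fun T : B → ℕ =>
    ∏ b, (∑ a with π a = b, y T a) ^ T b
  simp only [nsmul_eq_mul, Fintype.card_fin] at words_A words_B
  rw [← words_A, ← words_B, ← Finset.sum_fiberwise _ fun f : Fin n → A => π ∘ f]
  refine Finset.sum_congr rfl fun g _ => ?_
  rw [← prod_comp_eq_prod_pow_valueCount g fun b => ∑ a with π a = b, y (valueCount g) a,
    Finset.prod_univ_sum]
  refine Finset.sum_congr ?_ fun f hf => ?_
  · ext f; simp [funext_iff, Fintype.mem_piFinset]
  · have hf : π ∘ f = g := funext (by simpa [Fintype.mem_piFinset] using hf)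
    rw [fiberCount_valueCount, hf, prod_comp_eq_prod_pow_valueCount f]

lemma valueCount_insertNth {n : ℕ} (i : Fin (n + 1)) (u : A) (f : Fin n → A) :
    valueCount (i.insertNth u f) = valueCount f + Pi.single u 1 := by
  funext a
  simp only [valueCount, Finset.card_filter, Fin.sum_univ_succAbove _ i, Fin.insertNth_apply_same,
    Fin.insertNth_apply_succAbove, Pi.add_apply, Pi.single_apply, eq_comm (a := a)]
  exact add_comm _ _

lemma sum_multinomial_mul_apply [Fintype A] {R : Type*} [CommSemiring R] (n : ℕ) (u : A)
    (g : (A → ℕ) → R) :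
    ∑ N ∈ Finset.univ.piAntidiag (n + 1),
      (Nat.multinomial Finset.univ N : R) * ((N u : R) * g N) =
    (n + 1) * ∑ N ∈ Finset.univ.piAntidiag n,
      (Nat.multinomial Finset.univ N : R) * g (N + Pi.single u 1) := by
  have words_succ := sum_comp_valueCount (ι := Fin (n + 1)) fun N : A → ℕ => (N u : R) * g N
  have words := sum_comp_valueCount (ι := Fin n) fun N : A → ℕ => g (N + Pi.single u 1)
  simp only [nsmul_eq_mul, Fintype.card_fin] at words_succ words
  rw [← words_succ, ← words]
  have fixed_position (i : Fin (n + 1)) :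
      ∑ f : Fin (n + 1) → A, (if f i = u then g (valueCount f) else 0) =
        ∑ f : Fin n → A, g (valueCount f + Pi.single u 1) := by
    rw [← (Fin.insertNthEquiv (fun _ => A) i).sum_comp, Fintype.sum_prod_type]
    simp [Fin.insertNthEquiv, valueCount_insertNth]
  calc ∑ f : Fin (n + 1) → A, (valueCount f u : R) * g (valueCount f)
      = ∑ f : Fin (n + 1) → A, ∑ i, if f i = u then g (valueCount f) else 0 := by
        refine Finset.sum_congr rfl fun f _ => ?_
        rw [valueCount, Finset.card_filter, Nat.cast_sum, Finset.sum_mul]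
        simp
    _ = _ := by
        rw [Finset.sum_comm, Finset.sum_congr rfl fun i _ => fixed_position i]
        simp

end Words

/-! ### A series that is summed layer by layer -/

section Series

/-- The summand for the occupation numbers `t` of a series of nested exponential series: the rate of
the layer `s` is affine in the occupation numbers of the layers below `s`. -/
def layerTerm {𝕜 : Type*} [RCLike 𝕜] {m : ℕ} (k : Fin m → Fin m → 𝕜) (ρ κ : Fin m → 𝕜)
    (t : Fin m → ℕ) : 𝕜 :=
  ∏ s, (ρ s * (κ s + ∑ j with j < s, k s j * t j)) ^ t s / (t s).factorial

variable {𝕜 : Type*} [RCLike 𝕜] {m : ℕ}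

lemma layerTerm_mul_prod_pow (k : Fin m → Fin m → 𝕜) (ρ κ E : Fin m → 𝕜) (t : Fin m → ℕ) :
    layerTerm k ρ κ t * ∏ s, E s ^ t s = layerTerm k (fun s => ρ s * E s) κ t := by
  rw [layerTerm, layerTerm, ← Finset.prod_mul_distrib]
  refine Finset.prod_congr rfl fun s _ => ?_
  simp only [mul_pow]
  ring

lemma layerTerm_snoc (k : Fin (m + 1) → Fin (m + 1) → 𝕜) (ρ κ : Fin (m + 1) → 𝕜) (t : Fin m → ℕ)
    (x : ℕ) :
    layerTerm k ρ κ (Fin.snoc (α := fun _ => ℕ) t x) =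
      layerTerm (fun i j => k i.castSucc j.castSucc) (fun i => ρ i.castSucc)
        (fun i => κ i.castSucc) t *
      ((ρ (Fin.last m) * (κ (Fin.last m) + ∑ j : Fin m, k (Fin.last m) j.castSucc * t j)) ^ x /
        x.factorial) := by
  have sum_below : ∀ s : Fin m,
      ∑ j with j < s.castSucc, k s.castSucc j * (Fin.snoc (α := fun _ => ℕ) t x j : ℕ) =
        ∑ j with j < s, k s.castSucc j.castSucc * t j := fun s => by
    rw [Finset.sum_filter, Fin.sum_univ_castSucc, Finset.sum_filter]
    simp [Fin.le_last]
  have sum_below_last :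
      ∑ j with j < Fin.last m, k (Fin.last m) j * (Fin.snoc (α := fun _ => ℕ) t x j : ℕ) =
        ∑ j : Fin m, k (Fin.last m) j.castSucc * t j := by
    rw [Finset.sum_filter, Fin.sum_univ_castSucc]
    simp [Fin.castSucc_lt_last]
  rw [layerTerm, Fin.prod_univ_castSucc]
  simp only [Fin.snoc_castSucc, Fin.snoc_last, sum_below, sum_below_last, layerTerm]

/-- Summing over the top layer gives the exponential of an affine function of the other occupation
numbers, which only rescales the coefficients `ρ` of the lower layers. -/
lemma hasSum_layerTerm_snoc (k : Fin (m + 1) → Fin (m + 1) → 𝕜) (ρ κ : Fin (m + 1) → 𝕜)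
    (t : Fin m → ℕ) :
    HasSum (fun x : ℕ => layerTerm k ρ κ (Fin.snoc (α := fun _ => ℕ) t x))
      (NormedSpace.exp (ρ (Fin.last m) * κ (Fin.last m)) *
        layerTerm (fun i j => k i.castSucc j.castSucc)
          (fun i => ρ i.castSucc * NormedSpace.exp (ρ (Fin.last m) * k (Fin.last m) i.castSucc))
          (fun i => κ i.castSucc) t) := by
  have exp_rate : NormedSpace.exp (ρ (Fin.last m) *
      (κ (Fin.last m) + ∑ j : Fin m, k (Fin.last m) j.castSucc * t j)) =
      NormedSpace.exp (ρ (Fin.last m) * κ (Fin.last m)) *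
        ∏ j : Fin m, NormedSpace.exp (ρ (Fin.last m) * k (Fin.last m) j.castSucc) ^ t j := by
    simp only [mul_add, Finset.mul_sum, NormedSpace.exp_add, NormedSpace.exp_sum,
      ← NormedSpace.exp_nsmul, nsmul_eq_mul, mul_assoc, mul_comm (t _ : 𝕜)]
  rw [← layerTerm_mul_prod_pow, mul_left_comm, ← exp_rate]
  simp only [layerTerm_snoc]
  exact (NormedSpace.expSeries_div_hasSum_exp (𝔸 := 𝕜) (ρ (Fin.last m) *
    (κ (Fin.last m) + ∑ j : Fin m, k (Fin.last m) j.castSucc * t j))).mul_left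
      (layerTerm (fun i j => k i.castSucc j.castSucc) (fun i => ρ i.castSucc)
        (fun i => κ i.castSucc) t)

lemma layerTerm_nonneg {k : Fin m → Fin m → ℝ} {ρ κ : Fin m → ℝ} (hk : ∀ i j, 0 ≤ k i j)
    (hρ : ∀ i, 0 ≤ ρ i) (hκ : ∀ i, 0 ≤ κ i) (t : Fin m → ℕ) : 0 ≤ layerTerm k ρ κ t :=
  Finset.prod_nonneg fun s _ => div_nonneg (pow_nonneg (mul_nonneg (hρ s) <| add_nonneg (hκ s) <|
    Finset.sum_nonneg fun j _ => mul_nonneg (hk s j) (t j).cast_nonneg) _) (Nat.cast_nonneg _)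

/-- Split off the last occupation number. -/
def snocEquivProd (m : ℕ) : (Fin m → ℕ) × ℕ ≃ (Fin (m + 1) → ℕ) :=
  (Equiv.prodComm _ _).trans (Fin.snocEquiv fun _ => ℕ)

lemma snocEquivProd_apply (x : (Fin m → ℕ) × ℕ) :
    snocEquivProd m x = Fin.snoc (α := fun _ => ℕ) x.1 x.2 := rfl

lemma summable_layerTerm_of_nonneg {k : Fin m → Fin m → ℝ} {ρ κ : Fin m → ℝ}
    (hk : ∀ i j, 0 ≤ k i j) (hρ : ∀ i, 0 ≤ ρ i) (hκ : ∀ i, 0 ≤ κ i) :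
    Summable (layerTerm k ρ κ) := by
  induction m with
  | zero => exact Summable.of_finite
  | succ m ih =>
    refine (snocEquivProd m).summable_iff.1
      ((summable_prod_of_nonneg fun x => layerTerm_nonneg hk hρ hκ _).2
        ⟨fun t => (hasSum_layerTerm_snoc k ρ κ t).summable, ?_⟩)
    simp only [snocEquivProd_apply, (hasSum_layerTerm_snoc k ρ κ _).tsum_eq,
      ← Real.exp_eq_exp_ℝ]
    exact (ih (fun i j => hk _ _) (fun i => mul_nonneg (hρ _) (Real.exp_nonneg _))
      fun i => hκ _).mul_left _

lemma norm_layerTerm_le (k : Fin m → Fin m → 𝕜) (ρ κ : Fin m → 𝕜) (t : Fin m → ℕ) :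
    ‖layerTerm k ρ κ t‖ ≤
      layerTerm (fun i j => ‖k i j‖) (fun i => ‖ρ i‖) (fun i => ‖κ i‖) t := by
  rw [layerTerm, norm_prod]
  refine Finset.prod_le_prod (fun _ _ => norm_nonneg _) fun s _ => ?_
  rw [norm_div, norm_pow, norm_mul, RCLike.norm_natCast]
  have norm_rate_le : ‖κ s + ∑ j with j < s, k s j * t j‖ ≤
      ‖κ s‖ + ∑ j with j < s, ‖k s j‖ * t j := by
    refine (norm_add_le _ _).trans (add_le_add_right ((norm_sum_le _ _).trans_eq ?_) _)
    simp only [norm_mul, RCLike.norm_natCast]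
  gcongr

lemma summable_layerTerm (k : Fin m → Fin m → 𝕜) (ρ κ : Fin m → 𝕜) :
    Summable (layerTerm k ρ κ) :=
  .of_norm_bounded (summable_layerTerm_of_nonneg (fun _ _ => norm_nonneg _)
    (fun _ => norm_nonneg _) fun _ => norm_nonneg _) (norm_layerTerm_le k ρ κ)

variable {α : Type*}

/-- The update of the coefficients `ρ` when the layer `s` is summed, which is also one step of the
iteration that computes `R`. -/
def sweepStep (k : α → α → ℂ) (ρ : α → ℂ) (s : α) : α → ℂ :=
  fun j => ρ j * Complex.exp (ρ s * k s j)

lemma foldl_sweepStep_apply (k : α → α → ℂ) (L : List α) (j : α) (h : ∀ s ∈ L, k s j = 0)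
    (ρ : α → ℂ) : L.foldl (sweepStep k) ρ j = ρ j := by
  induction L generalizing ρ with
  | nil => rfl
  | cons s L ih =>
    rw [List.foldl_cons, ih fun t ht => h t (List.mem_cons_of_mem _ ht)]
    simp [sweepStep, h s List.mem_cons_self]

lemma hasSum_layerTerm {d : Fin m → α} {k : α → α → ℂ}
    (hk : ∀ i j, i ≤ j → k (d i) (d j) = 0) (ρ : α → ℂ) (κ : Fin m → ℂ) :
    HasSum (layerTerm (fun i j => k (d i) (d j)) (fun i => ρ (d i)) κ)
      (Complex.exp (∑ s, (List.ofFn d).reverse.foldl (sweepStep k) ρ (d s) * κ s)) := by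
  induction m generalizing ρ with
  | zero => simpa [layerTerm] using hasSum_unique (layerTerm (fun i j => k (d i) (d j)) _ κ)
  | succ m ih =>
    have foldl_eq : (List.ofFn d).reverse.foldl (sweepStep k) ρ =
        (List.ofFn fun i : Fin m => d i.castSucc).reverse.foldl (sweepStep k)
          (sweepStep k ρ (d (Fin.last m))) := by
      rw [List.ofFn_succ', List.concat_eq_append, List.reverse_append]
      rfl
    have foldl_last : (List.ofFn d).reverse.foldl (sweepStep k) ρ (d (Fin.last m)) =
        ρ (d (Fin.last m)) :=
      foldl_sweepStep_apply k _ _ (fun s hs => by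
        obtain ⟨i, rfl⟩ := List.mem_ofFn.1 (List.mem_reverse.1 hs)
        exact hk _ _ (Fin.le_last i)) ρ
    have summed := (summable_layerTerm (fun i j => k (d i) (d j)) (fun i => ρ (d i)) κ).hasSum
    rw [← (snocEquivProd m).hasSum_iff] at summed
    have lower := summed.prod_fiberwise fun t =>
      hasSum_layerTerm_snoc (fun i j => k (d i) (d j)) (fun i => ρ (d i)) κ t
    have closed_form := (ih (fun i j hij => hk _ _ (Fin.castSucc_le_castSucc_iff.2 hij))
      (sweepStep k ρ (d (Fin.last m))) (fun i => κ i.castSucc)).mul_left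
      (Complex.exp (ρ (d (Fin.last m)) * κ (Fin.last m)))
    rw [Fin.sum_univ_castSucc, Complex.exp_add, mul_comm (Complex.exp _), foldl_last, foldl_eq]
    simp only [← Complex.exp_eq_exp_ℂ] at lower
    exact lower.unique closed_form ▸ (snocEquivProd m).hasSum_iff.1 summed

end Series

/-! ### Elementary limits -/

section Limits

lemma tendsto_natCast_sub_div (a : ℕ) :
    Tendsto (fun n : ℕ => ((n - a : ℕ) : ℂ) / n) atTop (𝓝 1) := by
  have h : Tendsto (fun n : ℕ => 1 - (a : ℂ) / n) atTop (𝓝 (1 - 0)) :=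
    tendsto_const_nhds.sub (tendsto_const_div_atTop_nhds_zero_nat (a : ℂ))
  rw [sub_zero] at h
  refine h.congr' ?_
  filter_upwards [eventually_gt_atTop a] with n hn
  have : (n : ℂ) ≠ 0 := Nat.cast_ne_zero.2 (by omega)
  rw [Nat.cast_sub hn.le]
  field_simp

lemma tendsto_descFactorial_div_pow (a s : ℕ) :
    Tendsto (fun n : ℕ => ((n - a).descFactorial s : ℂ) / (n : ℂ) ^ s) atTop (𝓝 1) := by
  induction s with
  | zero => simp
  | succ s ih =>
    have h := (tendsto_natCast_sub_div (a + s)).mul ih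
    rw [one_mul] at h
    refine h.congr fun n => ?_
    rw [Nat.descFactorial_succ, pow_succ', Nat.cast_mul, mul_div_mul_comm, Nat.sub_sub]

lemma tendsto_mul_exp_div_sub_one (x : ℝ) :
    Tendsto (fun n : ℕ => n * (Real.exp (x / n) - 1)) atTop (𝓝 x) := by
  have slope : HasDerivAt (fun s : ℝ => Real.exp (x * s)) x 0 := by
    simpa using ((hasDerivAt_id (0 : ℝ)).const_mul x).exp
  have inv_tendsto : Tendsto (fun n : ℕ => (n : ℝ)⁻¹) atTop (𝓝[≠] 0) :=
    tendsto_nhdsWithin_iff.2 ⟨tendsto_inv_atTop_nhds_zero_nat,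
      (eventually_ne_atTop 0).mono fun n hn => by simpa using hn⟩
  refine (slope.tendsto_slope_zero.comp inv_tendsto).congr fun n => ?_
  simp [div_eq_mul_inv]

lemma tendsto_pow_sub_of_tendsto_mul_sub_one {z : ℕ → ℂ} {l : ℂ} (a : ℕ)
    (h : Tendsto (fun n => n * (z n - 1)) atTop (𝓝 l)) :
    Tendsto (fun n => z n ^ (n - a)) atTop (𝓝 (Complex.exp l)) := by
  have tendsto_pow : Tendsto (fun n => z n ^ n) atTop (𝓝 (Complex.exp l)) := by
    simpa using Complex.tendsto_one_add_pow_exp_of_tendsto h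
  have tendsto_one : Tendsto z atTop (𝓝 1) := by
    have h' := (h.mul (tendsto_inv_atTop_nhds_zero_nat (𝕜 := ℂ))).const_add 1
    rw [mul_zero, add_zero] at h'
    refine h'.congr' ?_
    filter_upwards [eventually_ne_atTop 0] with n hn
    have : (n : ℂ) ≠ 0 := Nat.cast_ne_zero.2 hn
    field_simp
    ring
  have quotient : Tendsto (fun n => z n ^ n / z n ^ a) atTop (𝓝 (Complex.exp l / 1 ^ a)) :=
    tendsto_pow.div (tendsto_one.pow a) (by simp)
  rw [one_pow, div_one] at quotient
  refine quotient.congr' ?_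
  filter_upwards [eventually_ge_atTop a, tendsto_one.eventually_ne one_ne_zero] with n hn hz
  rw [div_eq_iff (pow_ne_zero _ hz), ← pow_add, Nat.sub_add_cancel hn]

lemma abs_exp_neg_sub_exp_neg_le {x y : ℝ} (hx : 0 ≤ x) (hy : 0 ≤ y) :
    |Real.exp (-x) - Real.exp (-y)| ≤ |x - y| := by
  wlog hxy : x ≤ y generalizing x y
  · rw [abs_sub_comm, abs_sub_comm x]
    exact this hy hx (le_of_not_ge hxy)
  have exp_neg_y : Real.exp (-y) = Real.exp (-x) * Real.exp (-(y - x)) := by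
    rw [← Real.exp_add]; ring_nf
  have exp_neg_x_le : Real.exp (-x) ≤ 1 := Real.exp_le_one_iff.2 (by linarith)
  have one_sub_le := Real.one_sub_le_exp_neg (y - x)
  rw [abs_of_nonneg (sub_nonneg.2 (Real.exp_le_exp.2 (by linarith))),
    abs_of_nonpos (by linarith), exp_neg_y]
  nlinarith [Real.exp_pos (-x)]

end Limits

/-! ### Oscillating multinomial sums with paired classes -/

section WithTop

variable {m : ℕ}

lemma sum_withTop {M : Type*} [AddCommMonoid M] (h : WithTop (Fin m) → M) :
    ∑ o, h o = h ⊤ + ∑ i : Fin m, h i :=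
  Fintype.sum_option h

lemma prod_withTop {M : Type*} [CommMonoid M] (h : WithTop (Fin m) → M) :
    ∏ o, h o = h ⊤ * ∏ i : Fin m, h i :=
  Fintype.prod_option h

lemma multinomial_mul_prod_factorial (T : WithTop (Fin m) → ℕ) :
    Nat.multinomial Finset.univ T * ∏ i : Fin m, (T i).factorial =
      (∑ o, T o).descFactorial (∑ i : Fin m, T i) := by
  have multinomial_spec := Nat.multinomial_spec Finset.univ T
  have descFactorial_spec :=
    Nat.factorial_mul_descFactorial (n := ∑ o, T o) (k := ∑ i : Fin m, T i) (by simp [sum_withTop])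
  rw [show ∑ o, T o - ∑ i : Fin m, T i = T ⊤ by simp [sum_withTop], ← multinomial_spec,
    prod_withTop, mul_assoc] at descFactorial_spec
  rw [Nat.eq_of_mul_eq_mul_left (Nat.factorial_pos _) descFactorial_spec, mul_comm]

lemma sum_multinomial_withTop (g : (Fin m → ℕ) → WithTop (Fin m) → ℂ) (k : ℕ) :
    ∑ T ∈ Finset.piAntidiag (Finset.univ : Finset (WithTop (Fin m))) k,
      (Nat.multinomial Finset.univ T : ℂ) * ∏ o, g (fun i : Fin m => T i) o ^ T o =
    ∑' t : Fin m → ℕ, (k.descFactorial (∑ i, t i) : ℂ) * g t ⊤ ^ (k - ∑ i, t i) *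
      ∏ i : Fin m, (g t i ^ t i / (t i).factorial) := by
  have mem_iff : ∀ T : WithTop (Fin m) → ℕ, T ∈ Finset.piAntidiag Finset.univ k ↔
      T ⊤ + ∑ i : Fin m, T i = k := by simp [sum_withTop]
  classical
  rw [tsum_eq_sum (s := (Finset.piAntidiag Finset.univ k).image
    fun (T : WithTop (Fin m) → ℕ) (i : Fin m) => T i), Finset.sum_image]
  · refine Finset.sum_congr rfl fun T hT => ?_
    rw [mem_iff, ← sum_withTop T] at hT
    subst hT
    rw [← multinomial_mul_prod_factorial, show ∑ o, T o - ∑ i : Fin m, T i = T ⊤ by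
      simp [sum_withTop], prod_withTop, Finset.prod_div_distrib]
    have : (∏ i : Fin m, ((T i).factorial : ℂ)) ≠ 0 :=
      Finset.prod_ne_zero_iff.2 fun i _ => Nat.cast_ne_zero.2 (Nat.factorial_ne_zero _)
    push_cast
    field_simp
  · intro T hT T' hT' heq
    rw [Finset.mem_coe, mem_iff] at hT hT'
    have sum_eq : ∑ i : Fin m, T i = ∑ i : Fin m, T' i := congrArg (fun t => ∑ i, t i) heq
    funext o
    induction o with
    | top => omega
    | coe i => exact congrFun heq i
  · intro t ht
    have sum_gt : k < ∑ i, t i := by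
      by_contra! sum_le
      refine ht (Finset.mem_image.2 ⟨fun o => WithTop.recTopCoe (k - ∑ i, t i) t o, ?_, rfl⟩)
      exact (mem_iff _).2 (Nat.sub_add_cancel sum_le)
    simp [Nat.descFactorial_of_lt sum_gt]

end WithTop

/-- A finite set of classes with complex weights `q` and coefficients `P` of a quadratic form. The
classes are partitioned into pairs `rep i`, `opp i` with opposite weights, and the remaining ones,
of level `⊤`, whose weights form a probability distribution. Classes of equal level cannot be
distinguished by `P` from those of higher level, so only the difference between the members of a
pair as seen from the lower levels matters. -/
structure PairedSystem (A : Type*) [Fintype A] [DecidableEq A] (m : ℕ) where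
  level : A → WithTop (Fin m)
  P : A → A → ℝ
  q : A → ℂ
  wt : A → ℝ
  rep : Fin m → A
  opp : Fin m → A
  P_comm : ∀ a b, P a b = P b a
  P_nonneg : ∀ a b, 0 ≤ P a b
  P_eq_zero : ∀ a b, level a = level b → P a b = 0
  P_congr : ∀ a a' b, level a = level a' → level a ≤ level b → P a b = P a' b
  rep_ne_opp : ∀ i, rep i ≠ opp i
  level_eq_iff : ∀ a (i : Fin m), level a = (i : WithTop (Fin m)) ↔ a = rep i ∨ a = opp i
  q_opp : ∀ i, q (opp i) = -q (rep i)
  wt_nonneg : ∀ a, 0 ≤ wt a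
  q_eq : ∀ a, level a = ⊤ → q a = wt a
  sum_wt : ∑ a with level a = ⊤, wt a = 1

namespace PairedSystem

variable {A : Type*} [Fintype A] [DecidableEq A] {m : ℕ} (S : PairedSystem A m)

/-- The quadratic form of the occupation numbers `N`. -/
def quad (N : A → ℕ) : ℝ := ∑ a, ∑ b, S.P a b * N a * N b

/-- The linear form by which the fixed occupation numbers `c` act on the class `b`. -/
def lin (c : A → ℕ) (b : A) : ℝ := ∑ a, c a * S.P a b

/-- The total coefficient of the occupation number of `b`, when `t` are the occupation numbers of
the pairs and `c` is a fixed background. -/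
def load (c : A → ℕ) (t : Fin m → ℕ) (b : A) : ℝ :=
  S.lin c b + ∑ i : Fin m with ((i : Fin m) : WithTop (Fin m)) < S.level b, t i * S.P (S.rep i) b

@[simp] lemma level_rep (i : Fin m) : S.level (S.rep i) = i := (S.level_eq_iff _ _).2 (Or.inl rfl)

@[simp] lemma level_opp (i : Fin m) : S.level (S.opp i) = i := (S.level_eq_iff _ _).2 (Or.inr rfl)

lemma sum_level_eq (i : Fin m) (f : A → ℂ) :
    ∑ b with S.level b = i, f b = f (S.rep i) + f (S.opp i) := by
  rw [show (Finset.univ.filter fun b => S.level b = i) = {S.rep i, S.opp i} by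
    ext b; simp [S.level_eq_iff], Finset.sum_pair (S.rep_ne_opp i)]

lemma sum_q : ∑ b with S.level b = ⊤, S.q b = 1 := by
  rw [Finset.sum_congr rfl fun b hb => S.q_eq b (Finset.mem_filter.1 hb).2]
  exact_mod_cast S.sum_wt

lemma load_nonneg (c : A → ℕ) (t : Fin m → ℕ) (b : A) : 0 ≤ S.load c t b :=
  add_nonneg (Finset.sum_nonneg fun a _ => mul_nonneg (Nat.cast_nonneg _) (S.P_nonneg a b))
    (Finset.sum_nonneg fun _ _ => mul_nonneg (Nat.cast_nonneg _) (S.P_nonneg _ _))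

lemma sum_lt_level_mul_P (N : A → ℕ) (b : A) :
    ∑ a with S.level a < S.level b, N a * S.P a b =
      ∑ i : Fin m with ((i : Fin m) : WithTop (Fin m)) < S.level b,
        fiberCount S.level N i * S.P (S.rep i) b := by
  rw [Finset.sum_filter, Finset.sum_filter, ← Finset.sum_fiberwise _ S.level, sum_withTop,
    Finset.sum_eq_zero (s := Finset.univ.filter fun a => S.level a = ⊤)
      fun a ha => if_neg (by simp [(Finset.mem_filter.1 ha).2]), zero_add]
  refine Finset.sum_congr rfl fun i _ => ?_
  split_ifs with hi
  · rw [fiberCount, Nat.cast_sum, Finset.sum_mul]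
    refine Finset.sum_congr rfl fun a ha => ?_
    have level_a : S.level a = i := (Finset.mem_filter.1 ha).2
    rw [if_pos (level_a ▸ hi), S.P_congr a (S.rep i) b (by simp [level_a]) (level_a ▸ hi.le)]
  · exact Finset.sum_eq_zero fun a ha => if_neg ((Finset.mem_filter.1 ha).2 ▸ hi)

lemma quad_eq_two_mul_sum (N : A → ℕ) :
    S.quad N = 2 * ∑ b, N b * ∑ a with S.level a < S.level b, N a * S.P a b := by
  have sum_below : ∑ b, N b * ∑ a with S.level a < S.level b, N a * S.P a b =
      ∑ b, ∑ a, if S.level a < S.level b then S.P a b * N a * N b else 0 := by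
    refine Finset.sum_congr rfl fun b _ => ?_
    rw [Finset.mul_sum, Finset.sum_filter]
    refine Finset.sum_congr rfl fun a _ => ?_
    congr 1
    ring
  have split : ∀ a b, S.P a b * N a * N b =
      (if S.level a < S.level b then S.P a b * N a * N b else 0) +
      (if S.level b < S.level a then S.P b a * N b * N a else 0) := by
    intro a b
    rcases lt_trichotomy (S.level a) (S.level b) with h | h | h
    · simp [h, h.not_gt]
    · simp [h, S.P_eq_zero a b h]
    · simp [h, h.not_gt, S.P_comm a b]; ring
  rw [sum_below, quad, Finset.sum_congr rfl fun a _ => Finset.sum_congr rfl fun b _ => split a b]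
  simp only [Finset.sum_add_distrib]
  rw [two_mul, Finset.sum_comm]

lemma quad_add (N c : A → ℕ) :
    S.quad (N + c) = S.quad N + S.quad c + 2 * ∑ b, N b * S.lin c b := by
  have cross_left : ∑ b, N b * S.lin c b = ∑ a, ∑ b, S.P a b * c a * N b := by
    rw [Finset.sum_comm]
    refine Finset.sum_congr rfl fun b _ => ?_
    rw [lin, Finset.mul_sum]
    exact Finset.sum_congr rfl fun a _ => by ring
  have cross_right : ∑ b, N b * S.lin c b = ∑ a, ∑ b, S.P a b * N a * c b := by
    refine Finset.sum_congr rfl fun b _ => ?_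
    rw [lin, Finset.mul_sum]
    exact Finset.sum_congr rfl fun a _ => by rw [S.P_comm]; ring
  rw [two_mul]
  nth_rw 1 [cross_left]
  rw [cross_right]
  simp only [quad, ← Finset.sum_add_distrib]
  refine Finset.sum_congr rfl fun a _ => Finset.sum_congr rfl fun b _ => ?_
  simp only [Pi.add_apply, Nat.cast_add]
  ring

lemma quad_add_eq_load (N c : A → ℕ) :
    S.quad (N + c) = S.quad c + 2 * ∑ b, N b * S.load c (fun i => fiberCount S.level N i) b := by
  rw [quad_add, quad_eq_two_mul_sum]
  simp only [load, sum_lt_level_mul_P, mul_add, Finset.sum_add_distrib]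
  ring

lemma load_opp_sub_load_rep (c : A → ℕ) (t : Fin m → ℕ) (i : Fin m) :
    S.load c t (S.opp i) - S.load c t (S.rep i) =
      (S.lin c (S.opp i) - S.lin c (S.rep i)) +
        ∑ j with j < i, (S.P (S.opp i) (S.rep j) - S.P (S.rep i) (S.rep j)) * t j := by
  simp only [load, level_rep, level_opp, WithTop.coe_lt_coe]
  rw [add_sub_add_comm, ← Finset.sum_sub_distrib]
  congr 1
  refine Finset.sum_congr rfl fun j _ => ?_
  rw [S.P_comm (S.opp i), S.P_comm (S.rep i)]; ring

/-- The weighted sum over the occupation numbers `N + c` of total number `n`, with the multinomial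
coefficient and the weights of `N` alone. -/
def bulkSum (n : ℕ) (c : A → ℕ) : ℂ :=
  ∑ N ∈ Finset.piAntidiag Finset.univ (n - ∑ a, c a),
    (Nat.multinomial Finset.univ N : ℂ) *
      ((Real.exp (-(1 / (4 * n)) * S.quad (N + c)) : ℝ) * ∏ a, S.q a ^ N a)

/-- The weight of `b` in the presence of the occupation numbers `t` of the pairs. -/
def dressed (n : ℕ) (c : A → ℕ) (t : Fin m → ℕ) (b : A) : ℂ :=
  S.q b * (Real.exp (-(S.load c t b / 2) / n) : ℝ)

/-- The contribution to `bulkSum` of the occupation numbers `t` of the pairs. -/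
def bulkTerm (n : ℕ) (c : A → ℕ) (t : Fin m → ℕ) : ℂ :=
  ((n - ∑ a, c a).descFactorial (∑ i, t i) : ℂ) *
    (∑ b with S.level b = ⊤, S.dressed n c t b) ^ (n - ∑ a, c a - ∑ i, t i) *
    ∏ i : Fin m, ((∑ b with S.level b = i, S.dressed n c t b) ^ t i / (t i).factorial)

lemma exp_quad_add_mul_prod_q (n : ℕ) (N c : A → ℕ) :
    (Real.exp (-(1 / (4 * n)) * S.quad (N + c)) : ℝ) * ∏ a, S.q a ^ N a =
      (Real.exp (-(1 / (4 * n)) * S.quad c) : ℝ) *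
        ∏ a, S.dressed n c (fun i => fiberCount S.level N i) a ^ N a := by
  have exp_load : Real.exp (-(1 / (4 * n)) *
      (2 * ∑ b, N b * S.load c (fun i => fiberCount S.level N i) b)) =
      ∏ b, Real.exp (-(S.load c (fun i => fiberCount S.level N i) b / 2) / n) ^ N b := by
    simp only [← Real.exp_nat_mul, ← Real.exp_sum, Finset.mul_sum]
    congr 1
    exact Finset.sum_congr rfl fun b _ => by ring
  rw [quad_add_eq_load, mul_add, Real.exp_add, exp_load]
  simp only [dressed, mul_pow, Finset.prod_mul_distrib]
  push_cast
  ring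

lemma bulkSum_eq_tsum_bulkTerm (n : ℕ) (c : A → ℕ) :
    S.bulkSum n c = (Real.exp (-(1 / (4 * n)) * S.quad c) : ℝ) * ∑' t, S.bulkTerm n c t := by
  have resummed := sum_multinomial_fiberCount S.level
    (fun T a => S.dressed n c (fun i => T i) a) (n - ∑ a, c a)
  rw [sum_multinomial_withTop (fun t o => ∑ b with S.level b = o, S.dressed n c t b)] at resummed
  unfold bulkTerm
  rw [← resummed, bulkSum, Finset.mul_sum]
  refine Finset.sum_congr rfl fun N _ => ?_
  rw [exp_quad_add_mul_prod_q, mul_left_comm]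

lemma tendsto_mul_dressed_sub (c : A → ℕ) (t : Fin m → ℕ) (b : A) :
    Tendsto (fun n : ℕ => n * (S.dressed n c t b - S.q b)) atTop
      (𝓝 (-(1 / 2) * (S.q b * S.load c t b))) := by
  have h := ((Complex.continuous_ofReal.tendsto _).comp
    (tendsto_mul_exp_div_sub_one (-(S.load c t b / 2)))).const_mul (S.q b)
  convert! h using 2 with n
  · simp only [dressed, Function.comp_apply, Complex.ofReal_mul, Complex.ofReal_sub,
      Complex.ofReal_natCast, Complex.ofReal_one]
    ring
  · push_cast
    ring

lemma tendsto_mul_sum_dressed_pair (c : A → ℕ) (t : Fin m → ℕ) (i : Fin m) :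
    Tendsto (fun n : ℕ => n * ∑ b with S.level b = i, S.dressed n c t b) atTop
      (𝓝 (S.q (S.rep i) * ((S.load c t (S.opp i) - S.load c t (S.rep i)) / 2))) := by
  convert! (S.tendsto_mul_dressed_sub c t (S.rep i)).add
    (S.tendsto_mul_dressed_sub c t (S.opp i)) using 2 with n
  · rw [sum_level_eq, q_opp]; ring
  · rw [q_opp]; ring

lemma tendsto_sum_dressed_top_pow (c : A → ℕ) (t : Fin m → ℕ) (k : ℕ) :
    Tendsto (fun n : ℕ => (∑ b with S.level b = ⊤, S.dressed n c t b) ^ (n - k)) atTop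
      (𝓝 (Complex.exp (∑ b with S.level b = ⊤, -(1 / 2) * (S.q b * S.load c t b)))) := by
  refine tendsto_pow_sub_of_tendsto_mul_sub_one k ?_
  refine (tendsto_finsetSum _ fun b _ => S.tendsto_mul_dressed_sub c t b).congr fun n => ?_
  rw [← Finset.mul_sum, Finset.sum_sub_distrib, sum_q]

/-- The factor that the classes of level `⊤` contribute to a class `u`. -/
def damping (u : A) : ℂ :=
  Complex.exp (-(1 / 2) * ∑ b with S.level b = ⊤, S.q b * (S.P b u : ℂ))

/-- The coupling of the pair `i` to the class `u`. -/
def coupling (i : Fin m) (u : A) : ℂ :=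
  1 / 2 * (S.q (S.rep i) * S.damping (S.rep i)) * ((S.P (S.opp i) u : ℂ) - S.P (S.rep i) u)

lemma exp_sum_load_top (c : A → ℕ) (t : Fin m → ℕ) :
    Complex.exp (∑ b with S.level b = ⊤, -(1 / 2) * (S.q b * S.load c t b)) =
      (∏ u, S.damping u ^ c u) * ∏ i, S.damping (S.rep i) ^ t i := by
  have load_top : ∀ b ∈ Finset.univ.filter (fun b => S.level b = ⊤), S.q b * (S.load c t b : ℂ) =
      (∑ u, (c u : ℂ) * (S.q b * S.P b u)) + ∑ i, (t i : ℂ) * (S.q b * S.P b (S.rep i)) := by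
    intro b hb
    simp only [load, lin, (Finset.mem_filter.1 hb).2, WithTop.coe_lt_top, Finset.filter_true,
      S.P_comm _ b]
    push_cast
    simp only [mul_add, Finset.mul_sum, mul_left_comm (S.q b)]
  simp only [damping, ← Complex.exp_nat_mul, ← Complex.exp_sum, ← Complex.exp_add]
  rw [← Finset.mul_sum, Finset.sum_congr rfl load_top, Finset.sum_add_distrib, Finset.sum_comm,
    Finset.sum_comm (s := Finset.univ.filter fun b => S.level b = ⊤), mul_add]
  simp only [← Finset.mul_sum, mul_left_comm _ (-(1 / 2) : ℂ)]

lemma q_mul_load_sub_mul_damping (c : A → ℕ) (t : Fin m → ℕ) (i : Fin m) :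
    S.q (S.rep i) * (((S.load c t (S.opp i) : ℂ) - S.load c t (S.rep i)) / 2) *
      S.damping (S.rep i) = ∑ u, c u * S.coupling i u +
        ∑ j with j < i, S.coupling i (S.rep j) * t j := by
  have lin_coupling : S.q (S.rep i) * S.damping (S.rep i) / 2 *
      ((S.lin c (S.opp i) : ℂ) - S.lin c (S.rep i)) = ∑ u, c u * S.coupling i u := by
    simp only [lin, Complex.ofReal_sum, ← Finset.sum_sub_distrib, Finset.mul_sum]
    refine Finset.sum_congr rfl fun u _ => ?_
    rw [coupling, S.P_comm u, S.P_comm u]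
    push_cast
    ring
  rw [← lin_coupling, ← Complex.ofReal_sub, load_opp_sub_load_rep]
  push_cast
  rw [add_div, mul_add, add_mul, Finset.sum_div, Finset.mul_sum, Finset.sum_mul]
  congr 1
  · ring
  · refine Finset.sum_congr rfl fun j _ => ?_
    rw [coupling]; ring

lemma tendsto_bulkTerm (c : A → ℕ) (t : Fin m → ℕ) :
    Tendsto (fun n => S.bulkTerm n c t) atTop (𝓝 ((∏ u, S.damping u ^ c u) *
      layerTerm (fun i j => S.coupling i (S.rep j)) (fun _ => 1)
        (fun i => ∑ u, c u * S.coupling i u) t)) := by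
  have h := ((tendsto_descFactorial_div_pow (∑ a, c a) (∑ i, t i)).mul
    (S.tendsto_sum_dressed_top_pow c t (∑ a, c a + ∑ i, t i))).mul
    (tendsto_finsetProd Finset.univ fun i _ =>
      ((S.tendsto_mul_sum_dressed_pair c t i).pow (t i)).div_const ((t i).factorial : ℂ))
  convert! h.congr' ?_ using 2
  · rw [exp_sum_load_top, one_mul, mul_assoc, ← Finset.prod_mul_distrib, layerTerm]
    congr 1
    refine Finset.prod_congr rfl fun i _ => ?_
    rw [one_mul, ← q_mul_load_sub_mul_damping, mul_pow _ (S.damping (S.rep i))]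
    ring
  · filter_upwards [eventually_ne_atTop 0] with n hn
    have : (n : ℂ) ≠ 0 := Nat.cast_ne_zero.2 hn
    simp only [bulkTerm, mul_pow, mul_div_assoc, Finset.prod_mul_distrib, Nat.sub_sub,
      Finset.prod_pow_eq_pow_sum]
    field_simp

lemma norm_sum_dressed_top_le (n : ℕ) (c : A → ℕ) (t : Fin m → ℕ) :
    ‖∑ b with S.level b = ⊤, S.dressed n c t b‖ ≤ 1 := by
  refine (norm_sum_le _ _).trans (S.sum_wt.symm ▸ Finset.sum_le_sum fun b hb => ?_)
  have exp_le_one : Real.exp (-(S.load c t b / 2) / n) ≤ 1 := by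
    rw [Real.exp_le_one_iff, neg_div]
    have := S.load_nonneg c t b
    exact neg_nonpos.2 (by positivity)
  rw [dressed, S.q_eq b (Finset.mem_filter.1 hb).2, norm_mul, Complex.norm_real, Complex.norm_real,
    Real.norm_of_nonneg (S.wt_nonneg b), Real.norm_of_nonneg (Real.exp_nonneg _)]
  exact mul_le_of_le_one_right (S.wt_nonneg b) exp_le_one

/-- Half the difference between the quadratic coefficients of the members of the pair `i`, seen
from the pair `j`. -/
def pairGap (i j : Fin m) : ℝ := |S.P (S.opp i) (S.rep j) - S.P (S.rep i) (S.rep j)| / 2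

/-- Half the difference between the members of the pair `i`, seen from the background `c`. -/
def backgroundGap (c : A → ℕ) (i : Fin m) : ℝ := |S.lin c (S.opp i) - S.lin c (S.rep i)| / 2

lemma abs_load_opp_sub_load_rep_le (c : A → ℕ) (t : Fin m → ℕ) (i : Fin m) :
    |S.load c t (S.opp i) - S.load c t (S.rep i)| / 2 ≤
      S.backgroundGap c i + ∑ j with j < i, S.pairGap i j * t j := by
  rw [load_opp_sub_load_rep, div_le_iff₀ zero_lt_two, add_mul, Finset.sum_mul, backgroundGap,
    div_mul_cancel₀ _ two_ne_zero]
  refine (abs_add_le _ _).trans (add_le_add_right ((Finset.abs_sum_le_sum_abs _ _).trans_eq ?_) _)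
  refine Finset.sum_congr rfl fun j _ => ?_
  rw [pairGap, abs_mul, Nat.abs_cast]; ring

lemma mul_norm_sum_dressed_pair_le {n : ℕ} (hn : 0 < n) (c : A → ℕ) (t : Fin m → ℕ) (i : Fin m) :
    n * ‖∑ b with S.level b = i, S.dressed n c t b‖ ≤ ‖S.q (S.rep i)‖ *
      (S.backgroundGap c i + ∑ j with j < i, S.pairGap i j * t j) := by
  have hn' : (0 : ℝ) < n := Nat.cast_pos.2 hn
  have sum_dressed : ∑ b with S.level b = i, S.dressed n c t b = S.q (S.rep i) *
      ((Real.exp (-(S.load c t (S.rep i) / 2 / n)) -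
        Real.exp (-(S.load c t (S.opp i) / 2 / n)) : ℝ) : ℂ) := by
    rw [sum_level_eq, dressed, dressed, q_opp, neg_div, neg_div]; push_cast; ring
  have rep_nonneg := S.load_nonneg c t (S.rep i)
  have opp_nonneg := S.load_nonneg c t (S.opp i)
  rw [sum_dressed, norm_mul, mul_left_comm, Complex.norm_real, Real.norm_eq_abs]
  refine mul_le_mul_of_nonneg_left ?_ (norm_nonneg _)
  calc _ ≤ n * |S.load c t (S.rep i) / 2 / n - S.load c t (S.opp i) / 2 / n| :=
        mul_le_mul_of_nonneg_left
          (abs_exp_neg_sub_exp_neg_le (by positivity) (by positivity)) hn'.le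
    _ = |S.load c t (S.opp i) - S.load c t (S.rep i)| / 2 := by
        rw [abs_sub_comm, ← sub_div, ← sub_div, abs_div, abs_div, abs_of_pos hn', abs_two]
        field_simp
    _ ≤ _ := S.abs_load_opp_sub_load_rep_le c t i

lemma norm_bulkTerm_le {n : ℕ} (hn : 0 < n) (c : A → ℕ) (t : Fin m → ℕ) :
    ‖S.bulkTerm n c t‖ ≤
      layerTerm S.pairGap (fun i => ‖S.q (S.rep i)‖) (S.backgroundGap c) t := by
  have descFactorial_le : ‖((n - ∑ a, c a).descFactorial (∑ i, t i) : ℂ)‖ ≤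
      (n : ℝ) ^ (∑ i, t i) := by
    rw [Complex.norm_natCast]
    exact_mod_cast (Nat.descFactorial_le_pow _ _).trans (Nat.pow_le_pow_left (Nat.sub_le _ _) _)
  have top_le : ‖(∑ b with S.level b = ⊤, S.dressed n c t b) ^ (n - ∑ a, c a - ∑ i, t i)‖ ≤ 1 := by
    rw [norm_pow]
    exact pow_le_one₀ (norm_nonneg _) (S.norm_sum_dressed_top_le n c t)
  rw [bulkTerm, norm_mul, norm_mul, norm_prod]
  calc _ ≤ (n : ℝ) ^ (∑ i, t i) * 1 * ∏ i : Fin m,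
        ‖(∑ b with S.level b = i, S.dressed n c t b) ^ t i / ((t i).factorial : ℂ)‖ := by
        gcongr
    _ = ∏ i : Fin m, (n * ‖∑ b with S.level b = i, S.dressed n c t b‖) ^ t i /
        ((t i).factorial : ℝ) := by
        rw [mul_one, ← Finset.prod_pow_eq_pow_sum, ← Finset.prod_mul_distrib]
        refine Finset.prod_congr rfl fun i _ => ?_
        rw [norm_div, norm_pow, Complex.norm_natCast, mul_pow, mul_div_assoc]
    _ ≤ _ := Finset.prod_le_prod (fun i _ => by positivity) fun i _ =>
        div_le_div_of_nonneg_right (pow_le_pow_left₀ (by positivity)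
          (S.mul_norm_sum_dressed_pair_le hn c t i) _) (by positivity)

lemma tendsto_tsum_bulkTerm (c : A → ℕ) :
    Tendsto (fun n => ∑' t, S.bulkTerm n c t) atTop (𝓝 ((∏ u, S.damping u ^ c u) *
      ∑' t, layerTerm (fun i j => S.coupling i (S.rep j)) (fun _ => 1)
        (fun i => ∑ u, c u * S.coupling i u) t)) := by
  rw [← tsum_mul_left]
  exact tendsto_tsum_of_dominated_convergence
    (summable_layerTerm_of_nonneg (fun _ _ => div_nonneg (abs_nonneg _) zero_le_two)
      (fun _ => norm_nonneg _) fun _ => div_nonneg (abs_nonneg _) zero_le_two)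
    (fun t => S.tendsto_bulkTerm c t)
    ((eventually_gt_atTop 0).mono fun n hn t => S.norm_bulkTerm_le hn c t)

theorem tendsto_bulkSum (c : A → ℕ) :
    Tendsto (fun n => S.bulkSum n c) atTop (𝓝 ((∏ u, S.damping u ^ c u) *
      ∑' t, layerTerm (fun i j => S.coupling i (S.rep j)) (fun _ => 1)
        (fun i => ∑ u, c u * S.coupling i u) t)) := by
  have exponent : Tendsto (fun n : ℕ => -(1 / (4 * n)) * S.quad c) atTop (𝓝 0) := by
    have h := (tendsto_inv_atTop_nhds_zero_nat (𝕜 := ℝ)).const_mul (-(1 / 4) * S.quad c)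
    rw [mul_zero] at h
    exact h.congr fun n => by ring
  have prefactor := ((Complex.continuous_ofReal.comp Real.continuous_exp).tendsto 0).comp exponent
  simp only [Function.comp_apply, Real.exp_zero, Complex.ofReal_one] at prefactor
  have h := prefactor.mul (S.tendsto_tsum_bulkTerm c)
  rw [one_mul] at h
  exact h.congr fun n => (S.bulkSum_eq_tsum_bulkTerm n c).symm

end PairedSystem

/-! ### Gaussian integrals -/

section Gaussian

open scoped NNReal

lemma integral_exp_I_mul_gaussianReal (v : ℝ≥0) (t : ℝ) :
    ∫ x, Complex.exp (Complex.I * t * x) ∂(gaussianReal 0 v) =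
      Complex.exp (-(v * (t : ℂ) ^ 2 / 2)) := by
  have h := complexMGF_id_gaussianReal (μ := 0) (v := v) (Complex.I * t)
  rw [complexMGF] at h
  simp only [id] at h
  rw [h, mul_pow, Complex.I_sq]
  congr 1
  push_cast
  ring

lemma integral_mul_exp_I_mul_gaussianReal (v : ℝ≥0) (t : ℝ) :
    ∫ x, (x : ℂ) * Complex.exp (Complex.I * t * x) ∂(gaussianReal 0 v) =
      Complex.I * (v * t) * Complex.exp (-(v * (t : ℂ) ^ 2 / 2)) := by
  have deriv_integral := hasDerivAt_complexMGF (X := id) (μ := gaussianReal 0 v)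
    (z := Complex.I * t) (by simp [integrableExpSet_id_gaussianReal])
  have complexMGF_eq : complexMGF id (gaussianReal 0 v) = fun z => Complex.exp (v * z ^ 2 / 2) := by
    funext z
    simp [complexMGF_id_gaussianReal]
  rw [complexMGF_eq] at deriv_integral
  have deriv_exp : HasDerivAt (fun z : ℂ => Complex.exp (v * z ^ 2 / 2))
      (Complex.I * (v * t) * Complex.exp (-(v * (t : ℂ) ^ 2 / 2))) (Complex.I * t) := by
    refine (((hasDerivAt_pow 2 (Complex.I * (t : ℂ))).const_mul (v : ℂ)).div_const
      2).cexp.congr_deriv ?_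
    rw [mul_pow, Complex.I_sq]
    push_cast
    ring_nf
  exact deriv_integral.unique deriv_exp

variable {ι : Type*} [Fintype ι] (v : ι → ℝ≥0)

lemma integrable_eval_mul_exp_pi_gaussianReal (τ : ι → ℝ) (e : ι) :
    Integrable (fun J : ι → ℝ => (J e : ℂ) * Complex.exp (Complex.I * ∑ f, (τ f : ℂ) * J f))
      (Measure.pi fun f => gaussianReal 0 (v f)) := by
  have integrable_eval : Integrable (fun J : ι → ℝ => (J e : ℂ))
      (Measure.pi fun f => gaussianReal 0 (v f)) :=
    ((measurePreserving_eval (fun f => gaussianReal 0 (v f)) e).integrable_comp_of_integrable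
      ((memLp_id_gaussianReal 1).integrable le_rfl)).ofReal
  refine integrable_eval.mul_bdd (c := 1)
    (by fun_prop : Continuous fun J : ι → ℝ =>
      Complex.exp (Complex.I * ∑ f, (τ f : ℂ) * J f)).aestronglyMeasurable
    (.of_forall fun J => ?_)
  have ofReal_phase : ∑ f, (τ f : ℂ) * J f = ((∑ f, τ f * J f : ℝ) : ℂ) := by push_cast; rfl
  rw [ofReal_phase, mul_comm, Complex.norm_exp_ofReal_mul_I]

lemma integral_eval_mul_exp_pi_gaussianReal (τ : ι → ℝ) (e : ι) :
    ∫ J, (J e : ℂ) * Complex.exp (Complex.I * ∑ f, (τ f : ℂ) * J f)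
      ∂(Measure.pi fun f => gaussianReal 0 (v f)) =
      Complex.I * (v e * τ e) * Complex.exp (-(∑ f, v f * (τ f : ℂ) ^ 2) / 2) := by
  classical
  have integrand_eq : ∀ J : ι → ℝ,
      (J e : ℂ) * Complex.exp (Complex.I * ∑ f, (τ f : ℂ) * J f) =
        ∏ f, (if f = e then (J f : ℂ) else 1) * Complex.exp (Complex.I * τ f * J f) := by
    intro J
    rw [Finset.prod_mul_distrib, Finset.prod_ite_eq' Finset.univ e, if_pos (Finset.mem_univ e),
      Finset.mul_sum, Complex.exp_sum]
    simp only [mul_assoc]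
  have integral_factor : ∀ f, ∫ x : ℝ, (if f = e then (x : ℂ) else 1) *
      Complex.exp (Complex.I * τ f * x) ∂(gaussianReal 0 (v f)) =
        (if f = e then Complex.I * (v f * τ f) else 1) *
          Complex.exp (-(v f * (τ f : ℂ) ^ 2 / 2)) := by
    intro f
    by_cases hf : f = e
    · simp only [hf, if_true, integral_mul_exp_I_mul_gaussianReal]
    · simp only [hf, if_false, one_mul, integral_exp_I_mul_gaussianReal]
  simp only [integrand_eq]
  rw [integral_fintype_prod_eq_prod
    (f := fun f (x : ℝ) => (if f = e then (x : ℂ) else 1) * Complex.exp (Complex.I * τ f * x)),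
    Finset.prod_congr rfl fun f _ => integral_factor f, Finset.prod_mul_distrib,
    Finset.prod_ite_eq' Finset.univ e, if_pos (Finset.mem_univ e), ← Complex.exp_sum,
    Finset.sum_neg_distrib, ← Finset.sum_div, neg_div]

lemma integrable_sum_mul_exp_pi_gaussianReal (c τ : ι → ℝ) :
    Integrable (fun J : ι → ℝ => ((∑ e, c e * J e : ℝ) : ℂ) *
      Complex.exp (Complex.I * ∑ f, (τ f : ℂ) * J f))
      (Measure.pi fun f => gaussianReal 0 (v f)) := by
  simp only [Complex.ofReal_sum, Complex.ofReal_mul, Finset.sum_mul, mul_assoc]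
  exact integrable_finsetSum _ fun e _ =>
    (integrable_eval_mul_exp_pi_gaussianReal v τ e).const_mul _

lemma integral_sum_mul_exp_pi_gaussianReal (c τ : ι → ℝ) :
    ∫ J, ((∑ e, c e * J e : ℝ) : ℂ) * Complex.exp (Complex.I * ∑ f, (τ f : ℂ) * J f)
      ∂(Measure.pi fun f => gaussianReal 0 (v f)) =
      Complex.I * ((∑ e, v e * (c e * τ e) : ℝ) : ℂ) *
        (Real.exp (-(∑ f, v f * τ f ^ 2) / 2) : ℝ) := by
  simp only [Complex.ofReal_sum, Complex.ofReal_mul, Finset.sum_mul, mul_assoc]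
  rw [integral_finsetSum _ fun e _ =>
    (integrable_eval_mul_exp_pi_gaussianReal v τ e).const_mul _]
  simp only [integral_const_mul, integral_eval_mul_exp_pi_gaussianReal]
  push_cast
  rw [Finset.mul_sum]
  exact Finset.sum_congr rfl fun e _ => by ring

end Gaussian

/-! ### Configurations -/

section Configurations

variable {p : ℕ}

/-- The two halves of `a` agree at all positions after `r`; the part shared by `IsMirror a` and
`HasPivot a r`, and all that matters for how flipping the signs at `±r` acts on `Φ`. -/
def SymmAbove (r : Fin p) (a : Config p) : Prop := ∀ s, r < s → a.2 s = a.1 s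

lemma SymmAbove.mul {r : Fin p} {a b : Config p} (ha : SymmAbove r a) (hb : SymmAbove r b) :
    SymmAbove r (a * b) := fun s hs => by
  simp [ha s hs, hb s hs]

lemma SymmAbove.mono {a : Config p} {r s : Fin p} (h : SymmAbove r a) (hrs : r ≤ s) :
    SymmAbove s a := fun t ht => h t (hrs.trans_lt ht)

lemma IsMirror.symmAbove {a : Config p} (ha : IsMirror a) (r : Fin p) : SymmAbove r a :=
  fun s _ => ha s

lemma HasPivot.symmAbove {a : Config p} {r : Fin p} (ha : HasPivot a r) : SymmAbove r a := ha.2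

lemma isMirror_mul_self (a : Config p) : IsMirror (a * a) := fun s => by
  simp [Int.units_mul_self]

lemma HasPivot.not_isMirror {a : Config p} {r : Fin p} (h : HasPivot a r) : ¬ IsMirror a :=
  fun hm => units_ne_neg_self (a.1 r) ((hm r).symm.trans h.1)

lemma exists_hasPivot {a : Config p} (h : ¬ IsMirror a) : ∃ r, HasPivot a r := by
  obtain ⟨r, hr, hmax⟩ := wellFounded_gt.has_min {r | a.2 r ≠ a.1 r} (not_forall.1 h)
  exact ⟨r, Int.units_ne_iff_eq_neg.1 hr, fun s hs => by_contra fun hne => hmax s hne hs⟩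

protected lemma HasPivot.not_lt {a : Config p} {r s : Fin p} (hr : HasPivot a r)
    (hs : HasPivot a s) : ¬ r < s :=
  fun hlt => units_ne_neg_self (a.1 s) ((hr.2 s hlt).symm.trans hs.1)

lemma HasPivot.unique {a : Config p} {r s : Fin p} (hr : HasPivot a r) (hs : HasPivot a s) :
    r = s :=
  le_antisymm (not_lt.1 (hs.not_lt hr)) (not_lt.1 (hr.not_lt hs))

/-- The mirror configuration with entries `-1` exactly at `±r`. Multiplication by it flips the
signs there, so it turns `a` into `ā` when `r` is the pivot of `a`. -/
def flipAt (r : Fin p) : Config p := (Function.update 1 r (-1), Function.update 1 r (-1))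

lemma isMirror_flipAt (r : Fin p) : IsMirror (flipAt r) := fun _ => rfl

lemma HasPivot.bar_eq_flipAt_mul {a : Config p} {r : Fin p} (h : HasPivot a r) :
    bar a = flipAt r * a := by
  have hasPivot_iff : ∀ s, HasPivot a s ↔ s = r :=
    fun s => ⟨fun hs => hs.unique h, fun hs => hs ▸ h⟩
  ext s <;> by_cases hs : s = r <;> simp [bar, flipAt, hasPivot_iff, hs]

protected lemma HasPivot.bar {a : Config p} {r : Fin p} (h : HasPivot a r) :
    HasPivot (bar a) r := by
  rw [h.bar_eq_flipAt_mul]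
  exact ⟨by simp [flipAt, h.1], fun t ht => by simp [flipAt, h.2 t ht]⟩

lemma HasPivot.bar_fst {a : Config p} {r : Fin p} (h : HasPivot a r) :
    (bar a).1 r = -a.1 r := by
  simp [bar, h]

lemma IsMirror.bar_eq {a : Config p} (h : IsMirror a) : bar a = a := by
  have not_hasPivot : ∀ s, ¬ HasPivot a s := fun s hs => hs.not_isMirror h
  ext s <;> simp [bar, not_hasPivot]

lemma bar_bar (a : Config p) : bar (bar a) = a := by
  by_cases h : IsMirror a
  · rw [h.bar_eq, h.bar_eq]
  · obtain ⟨r, hr⟩ := exists_hasPivot h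
    have flipAt_mul_self : flipAt r * flipAt r = 1 := by
      ext s <;> by_cases hs : s = r <;> simp [flipAt, hs]
    rw [hr.bar.bar_eq_flipAt_mul, hr.bar_eq_flipAt_mul, ← mul_assoc, flipAt_mul_self, one_mul]

lemma not_isMirror_bar {a : Config p} (h : ¬ IsMirror a) : ¬ IsMirror (bar a) := by
  obtain ⟨r, hr⟩ := exists_hasPivot h
  exact hr.bar.not_isMirror

lemma bar_ne_self {a : Config p} (h : ¬ IsMirror a) : bar a ≠ a := by
  obtain ⟨r, hr⟩ := exists_hasPivot h
  exact fun he => units_ne_neg_self (a.1 r) (hr.bar_fst ▸ congrArg (fun b => b.1 r) he.symm)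

lemma starOp_mul (a b : Config p) : starOp (a * b) = starOp a * starOp b := by
  ext s <;> simp [starOp, Finset.prod_mul_distrib]

lemma starDiff_eq_zero {s : Fin p} {a : Config p} (h : ∀ t, s ≤ t → a.2 t = a.1 t) :
    starDiff a s = 0 := by
  have : ∏ t ∈ Finset.Ici s, a.2 t = ∏ t ∈ Finset.Ici s, a.1 t :=
    Finset.prod_congr rfl fun t ht => h t (Finset.mem_Ici.1 ht)
  simp [starDiff, starOp, this]

lemma starDiff_flipAt_mul {r s : Fin p} (hs : s ≤ r) (a : Config p) :
    starDiff (flipAt r * a) s = -starDiff a s := by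
  have prod_flip : ∏ t ∈ Finset.Ici s, (Function.update 1 r (-1) : Fin p → ℤˣ) t = -1 := by
    rw [Finset.prod_update_of_mem (by simpa using hs)]
    simp
  simp only [starDiff, starOp_mul]
  simp [starOp, flipAt, prod_flip]
  ring

lemma IsMirror.Phi_eq_zero {a : Config p} (h : IsMirror a) (γ : Fin p → ℝ) : Phi γ a = 0 := by
  simp [Phi, starDiff_eq_zero fun t _ => h t]

lemma SymmAbove.Phi_flipAt_mul (γ : Fin p → ℝ) {r : Fin p} {a : Config p} (h : SymmAbove r a) :
    Phi γ (flipAt r * a) = -Phi γ a := by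
  have h' : SymmAbove r (flipAt r * a) := ((isMirror_flipAt r).symmAbove r).mul h
  simp only [Phi, ← Finset.sum_neg_distrib]
  refine Finset.sum_congr rfl fun s _ => ?_
  rcases le_or_gt s r with hs | hs
  · simp [starDiff_flipAt_mul hs]
  · simp [starDiff_eq_zero fun t ht => h t (hs.trans_le ht),
      starDiff_eq_zero fun t ht => h' t (hs.trans_le ht)]

lemma HasPivot.Phi_bar_mul (γ : Fin p → ℝ) {r : Fin p} {b c : Config p} (hb : HasPivot b r)
    (hc : SymmAbove r c) : Phi γ (bar b * c) = -Phi γ (b * c) := by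
  rw [hb.bar_eq_flipAt_mul, mul_assoc, (hb.symmAbove.mul hc).Phi_flipAt_mul γ]

lemma playsWell_of_symmAbove (γ : Fin p → ℝ) {b c : Config p}
    (h : ∀ r, HasPivot b r → SymmAbove r c) : PlaysWell γ b c := by
  by_cases hb : IsMirror b
  · rw [PlaysWell, hb.bar_eq]
  · obtain ⟨r, hr⟩ := exists_hasPivot hb
    rw [PlaysWell, hr.Phi_bar_mul γ (h r hr), neg_sq]

lemma IsMirror.playsWell_right (γ : Fin p → ℝ) (b : Config p) {c : Config p} (hc : IsMirror c) :
    PlaysWell γ b c :=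
  playsWell_of_symmAbove γ fun r _ => hc.symmAbove r

lemma Phi_mul_self (γ : Fin p → ℝ) (b : Config p) : Phi γ (b * b) = 0 :=
  (isMirror_mul_self b).Phi_eq_zero γ

lemma Phi_bar_mul_self (γ : Fin p → ℝ) (b : Config p) : Phi γ (bar b * b) = 0 := by
  have h : PlaysWell γ b b := playsWell_of_symmAbove γ fun _ hr => hr.symmAbove
  rw [PlaysWell, Phi_mul_self] at h
  simpa using h

lemma Phi_sq_bar_sub_Phi_sq_bar_right (γ : Fin p → ℝ) (b c : Config p) :
    Phi γ (bar b * bar c) ^ 2 - Phi γ (b * bar c) ^ 2 =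
      Phi γ (bar b * c) ^ 2 - Phi γ (b * c) ^ 2 := by
  by_cases hb : IsMirror b
  · simp [hb.bar_eq]
  by_cases hc : IsMirror c
  · simp [hc.bar_eq]
  obtain ⟨r, hr⟩ := exists_hasPivot hb
  obtain ⟨s, hs⟩ := exists_hasPivot hc
  rcases le_total s r with h | h
  · rw [hr.Phi_bar_mul γ (hs.symmAbove.mono h), hr.Phi_bar_mul γ (hs.bar.symmAbove.mono h)]
    ring
  · rw [mul_comm, mul_comm b, hs.Phi_bar_mul γ (hr.bar.symmAbove.mono h),
      hs.Phi_bar_mul γ (hr.symmAbove.mono h), mul_comm c, mul_comm c]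
    ring

lemma PlaysWell.bar_right {γ : Fin p → ℝ} {b c : Config p} (h : PlaysWell γ b c) :
    PlaysWell γ b (bar c) :=
  sub_eq_zero.1 ((Phi_sq_bar_sub_Phi_sq_bar_right γ b c).trans (sub_eq_zero.2 h))

/-- The factor of `Q_a` that belongs to the entries `b = a_j` and `c = a_{-j}`, as a function of
`x = cos β_j` and `y = sin β_j`. -/
def qFactor (x y : ℂ) (b c : ℤˣ) : ℂ :=
  x ^ (theta b + theta c) * y ^ (theta (-b) + theta (-c)) *
    Complex.I ^ ((theta (-b) : ℤ) - (theta (-c) : ℤ))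

lemma Q_eq_prod_qFactor (β : Fin p → ℝ) (a : Config p) :
    Q β a = ∏ j, qFactor (Real.cos (β j)) (Real.sin (β j)) (a.1 j) (a.2 j) := rfl

lemma qFactor_neg_neg (x y : ℂ) (b : ℤˣ) : qFactor x y (-b) (- -b) = -qFactor x y b (-b) := by
  have neg_one_ne_one : (-1 : ℤˣ) ≠ 1 := by decide
  rcases Int.units_eq_one_or b with rfl | rfl <;> simp [qFactor, theta, neg_one_ne_one]

lemma qFactor_self (x y : ℂ) (b : ℤˣ) : qFactor x y b b = if b = 1 then x ^ 2 else y ^ 2 := by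
  have neg_one_ne_one : (-1 : ℤˣ) ≠ 1 := by decide
  rcases Int.units_eq_one_or b with rfl | rfl <;> simp [qFactor, theta, neg_one_ne_one]

lemma Q_bar (β : Fin p → ℝ) {a : Config p} (h : ¬ IsMirror a) : Q β (bar a) = -Q β a := by
  obtain ⟨r, hr⟩ := exists_hasPivot h
  have not_hasPivot : ∀ s, s ≠ r → ¬ HasPivot a s := fun s hs hp => hs (hp.unique hr)
  rw [Q_eq_prod_qFactor, Q_eq_prod_qFactor, ← Finset.mul_prod_erase _ _ (Finset.mem_univ r),
    ← Finset.mul_prod_erase _ _ (Finset.mem_univ r), ← neg_mul]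
  congr 1
  · simp only [bar, hr, if_true, hr.1, qFactor_neg_neg]
  · refine Finset.prod_congr rfl fun s hs => ?_
    simp [bar, not_hasPivot s (Finset.ne_of_mem_erase hs)]

/-- The value of `Q` at the mirror configuration with halves `b`: the probability
`∏_j |⟨b_j|e^{iβ_jX}|1⟩|²` that `p` independent spins read `b`. -/
def mirrorWeight (β : Fin p → ℝ) (b : Fin p → ℤˣ) : ℝ :=
  ∏ j, if b j = 1 then Real.cos (β j) ^ 2 else Real.sin (β j) ^ 2

lemma mirrorWeight_nonneg (β : Fin p → ℝ) (b : Fin p → ℤˣ) : 0 ≤ mirrorWeight β b :=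
  Finset.prod_nonneg fun j _ => by split_ifs <;> positivity

lemma sum_mirrorWeight (β : Fin p → ℝ) : ∑ b, mirrorWeight β b = 1 := by
  unfold mirrorWeight
  rw [← Fintype.prod_sum
    (fun (j : Fin p) (b : ℤˣ) => if b = 1 then Real.cos (β j) ^ 2 else Real.sin (β j) ^ 2)]
  refine Finset.prod_eq_one fun j _ => ?_
  rw [show (Finset.univ : Finset ℤˣ) = {1, -1} from rfl, Finset.sum_pair (by decide)]
  simp [show (-1 : ℤˣ) ≠ 1 by decide]

lemma IsMirror.Q_eq {a : Config p} (h : IsMirror a) (β : Fin p → ℝ) :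
    Q β a = (mirrorWeight β a.1 : ℂ) := by
  rw [Q_eq_prod_qFactor, mirrorWeight, Complex.ofReal_prod]
  refine Finset.prod_congr rfl fun j _ => ?_
  rw [h j, qFactor_self]
  split_ifs <;> push_cast <;> rfl

lemma sum_Q_isMirror (β : Fin p → ℝ) : ∑ a : Config p with IsMirror a, Q β a = 1 := by
  rw [← Complex.ofReal_one, ← sum_mirrorWeight β, Complex.ofReal_sum]
  refine Finset.sum_bij' (fun a _ => a.1) (fun b _ => (b, b)) (by simp)
    (fun b _ => Finset.mem_filter.2 ⟨Finset.mem_univ _, fun _ => rfl⟩) (fun a ha => ?_) (by simp)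
    fun a ha => IsMirror.Q_eq (by simpa using ha) β
  have ha : IsMirror a := by simpa using ha
  ext s <;> simp [ha s]

lemma F_bar (γ β : Fin p → ℝ) (b : Config p) : F γ β (bar b) = F γ β b := by
  unfold F
  congr 2
  refine Finset.sum_congr rfl fun a ha => ?_
  have h : PlaysWell γ b a := IsMirror.playsWell_right γ b (by simpa using ha)
  rw [PlaysWell] at h
  rw [mul_comm a, mul_comm a]
  norm_cast
  rw [h]

lemma X_bar (γ β : Fin p → ℝ) {b : Config p} (h : ¬ IsMirror b) :
    X γ β (bar b) = -X γ β b := by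
  rw [X, X, F_bar, Q_bar β h, neg_mul]

lemma PlaysWell.K_eq_zero {γ : Fin p → ℝ} (β : Fin p → ℝ) {b c : Config p}
    (h : PlaysWell γ b c) : K γ β b c = 0 := by
  have : (Phi γ (bar b * c) : ℂ) ^ 2 = (Phi γ (b * c) : ℂ) ^ 2 := mod_cast h
  rw [K, this, sub_self, mul_zero]

lemma K_bar_right (γ β : Fin p → ℝ) (b c : Config p) : K γ β b (bar c) = K γ β b c := by
  rw [K, K]
  congr 1
  exact_mod_cast Phi_sq_bar_sub_Phi_sq_bar_right γ b c

lemma IsMirror.W_eq {u : Config p} (h : IsMirror u) (γ β : Fin p → ℝ) (D : List (Config p)) :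
    W γ β D u = X γ β u := by
  simp [W, Y, (h.playsWell_right γ _).K_eq_zero β]

lemma W_bar (γ β : Fin p → ℝ) (D : List (Config p)) {u : Config p} (h : ¬ IsMirror u) :
    W γ β D (bar u) = -W γ β D u := by
  simp only [W, Y, K_bar_right, X_bar γ β h, neg_mul]

end Configurations

/-! ### Existence of admissible indexings -/

section Indexings

variable {p : ℕ}

lemma mem_allConfigs (a : Config p) : a ∈ allConfigs p := by simp [allConfigs]

/-- The configurations with pivot `r` and entry `1` there: one from each pair `b, b̄` with that
pivot. -/
def pivotLayer (r : Fin p) : List (Config p) :=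
  (allConfigs p).filter fun a => HasPivot a r ∧ a.1 r = 1

lemma mem_pivotLayer {r : Fin p} {a : Config p} :
    a ∈ pivotLayer r ↔ HasPivot a r ∧ a.1 r = 1 := by
  simp [pivotLayer, mem_allConfigs]

/-- One configuration of each pair `b, b̄`, ordered by decreasing pivot. This is the order of
`A_1, A_2, …, A_p`, and it is admissible for all `γ`. -/
def pivotIndexing (p : ℕ) : List (Config p) :=
  (List.finRange p).reverse.flatMap pivotLayer

lemma pairwise_gt_reverse_finRange (p : ℕ) : (List.finRange p).reverse.Pairwise (· > ·) :=
  List.pairwise_reverse.2 (List.pairwise_lt_finRange p)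

lemma HasPivot.mem_pivotIndexing {r : Fin p} {a : Config p} (h : HasPivot a r) :
    a ∈ pivotIndexing p ↔ a.1 r = 1 := by
  simp only [pivotIndexing, List.mem_flatMap, List.mem_reverse, List.mem_finRange, true_and,
    mem_pivotLayer]
  exact ⟨fun ⟨s, hs, h1⟩ => h.unique hs ▸ h1, fun h1 => ⟨r, h, h1⟩⟩

lemma nodup_pivotIndexing (p : ℕ) : (pivotIndexing p).Nodup := by
  refine List.nodup_flatMap.2 ⟨fun r _ => (Finset.nodup_toList _).filter _,
    (pairwise_gt_reverse_finRange p).imp fun {r s} hrs a ha hb => ?_⟩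
  exact hrs.ne ((mem_pivotLayer.1 hb).1.unique (mem_pivotLayer.1 ha).1)

lemma isHalf_pivotIndexing (p : ℕ) : IsHalf (pivotIndexing p) := by
  refine ⟨nodup_pivotIndexing p, fun b hb => ?_, fun b hb => ?_⟩
  · obtain ⟨r, -, hr⟩ := List.mem_flatMap.1 hb
    exact (mem_pivotLayer.1 hr).1.not_isMirror
  · obtain ⟨r, hr⟩ := exists_hasPivot hb
    rw [hr.mem_pivotIndexing, hr.bar.mem_pivotIndexing, hr.bar_fst]
    rcases Int.units_eq_one_or (b.1 r) with h | h <;> rw [h] <;> decide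

lemma isIndexing_pivotIndexing (γ : Fin p → ℝ) : IsIndexing γ (pivotIndexing p) := by
  have playsWell {r s : Fin p} (hsr : s ≤ r) {a b : Config p} (ha : a ∈ pivotLayer r)
      (hb : b ∈ pivotLayer s) : PlaysWell γ a b :=
    playsWell_of_symmAbove γ fun t ht =>
      (mem_pivotLayer.1 hb).1.symmAbove.mono (ht.unique (mem_pivotLayer.1 ha).1 ▸ hsr)
  refine ⟨isHalf_pivotIndexing p, List.pairwise_flatMap.2 ⟨fun r _ => ?_, ?_⟩⟩
  · exact List.pairwise_of_forall_mem_list fun a ha b hb => playsWell le_rfl ha hb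
  · exact (pairwise_gt_reverse_finRange p).imp fun hsr a ha b hb => playsWell hsr.le ha hb

end Indexings

/-! ### Limits of the sums over occupation numbers -/

section ConfigurationLimits

variable {p : ℕ} {γ : Fin p → ℝ} {D : List (Config p)}

/-- The index in `D` of the pair `{a, ā}`, and `⊤` for `a ∈ A_{p+1}`. -/
def levelOf (D : List (Config p)) (a : Config p) : WithTop (Fin D.length) :=
  if h : a ∈ D then (⟨D.idxOf a, List.idxOf_lt_length_of_mem h⟩ : Fin D.length)
  else if h : bar a ∈ D then (⟨D.idxOf (bar a), List.idxOf_lt_length_of_mem h⟩ : Fin D.length)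
  else ⊤

lemma IsHalf.levelOf_eq_top_iff (hD : IsHalf D) (a : Config p) :
    levelOf D a = ⊤ ↔ IsMirror a := by
  obtain ⟨-, notMirror, mem_iff⟩ := hD
  unfold levelOf
  by_cases ha : IsMirror a
  · have notMem : a ∉ D := fun h => notMirror a h ha
    simp [notMem, ha, ha.bar_eq]
  · by_cases mem : a ∈ D
    · simp [mem, ha]
    · have bar_mem : bar a ∈ D := not_not.1 (mt (mem_iff a ha).2 mem)
      simp [mem, bar_mem, ha]

lemma IsHalf.levelOf_eq_coe_iff (hD : IsHalf D) (a : Config p) (i : Fin D.length) :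
    levelOf D a = i ↔ a = D.get i ∨ a = bar (D.get i) := by
  have get_mem : D.get i ∈ D := D.get_mem i
  have idxOf_get : D.idxOf (D.get i) = i := List.get_idxOf hD.1 i
  unfold levelOf
  constructor
  · intro h
    split_ifs at h with mem bar_mem
    · left
      rw [← WithTop.coe_inj.1 h, List.idxOf_get]
    · right
      rw [← WithTop.coe_inj.1 h, List.idxOf_get, bar_bar]
    · exact absurd h WithTop.top_ne_coe
  · rintro (rfl | rfl)
    · rw [dif_pos get_mem, WithTop.coe_inj]
      exact Fin.ext idxOf_get
    · have bar_notMem : bar (D.get i) ∉ D := (hD.2.2 _ (hD.2.1 _ get_mem)).1 get_mem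
      rw [dif_neg bar_notMem, dif_pos (by rwa [bar_bar]), WithTop.coe_inj]
      exact Fin.ext (by simp only [bar_bar, idxOf_get])

lemma IsHalf.eq_or_eq_bar_of_levelOf_eq (hD : IsHalf D) {a b : Config p}
    (h : levelOf D a = levelOf D b) (ha : ¬ IsMirror a) : b = a ∨ b = bar a := by
  obtain ⟨i, hi⟩ := WithTop.ne_top_iff_exists.1 (mt (hD.levelOf_eq_top_iff a).1 ha)
  rcases (hD.levelOf_eq_coe_iff a i).1 hi.symm with rfl | rfl <;>
    rcases (hD.levelOf_eq_coe_iff b i).1 (hi ▸ h).symm with rfl | rfl <;> simp [bar_bar]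

lemma IsHalf.Phi_sq_mul_eq_zero (hD : IsHalf D) (γ : Fin p → ℝ) {a b : Config p}
    (h : levelOf D a = levelOf D b) : Phi γ (a * b) ^ 2 = 0 := by
  rw [sq_eq_zero_iff, mul_comm]
  by_cases ha : IsMirror a
  · have hb : IsMirror b := (hD.levelOf_eq_top_iff b).1 (h ▸ (hD.levelOf_eq_top_iff a).2 ha)
    exact IsMirror.Phi_eq_zero (fun s => congr_arg₂ (· * ·) (hb s) (ha s)) γ
  · rcases hD.eq_or_eq_bar_of_levelOf_eq h ha with rfl | rfl
    · exact Phi_mul_self γ b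
    · exact Phi_bar_mul_self γ a

lemma IsIndexing.playsWell_get (hD : IsIndexing γ D) {i j : Fin D.length} (hij : i ≤ j) :
    PlaysWell γ (D.get i) (D.get j) := by
  rcases hij.eq_or_lt with rfl | h
  · exact playsWell_of_symmAbove γ fun _ hr => hr.symmAbove
  · exact List.pairwise_iff_get.1 hD.2 i j h

lemma IsIndexing.playsWell_of_le_levelOf (hD : IsIndexing γ D) {i : Fin D.length} {b : Config p}
    (h : i ≤ levelOf D b) : PlaysWell γ (D.get i) b := by
  cases hb : levelOf D b with
  | top => exact ((hD.1.levelOf_eq_top_iff b).1 hb).playsWell_right γ _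
  | coe j =>
    rw [hb, WithTop.coe_le_coe] at h
    rcases (hD.1.levelOf_eq_coe_iff b j).1 hb with rfl | rfl
    · exact hD.playsWell_get h
    · exact (hD.playsWell_get h).bar_right

lemma IsIndexing.Phi_sq_mul_congr (hD : IsIndexing γ D) {a a' b : Config p}
    (h : levelOf D a = levelOf D a') (hb : levelOf D a ≤ levelOf D b) :
    Phi γ (a * b) ^ 2 = Phi γ (a' * b) ^ 2 := by
  cases ha : levelOf D a with
  | top =>
    have hb : levelOf D b = ⊤ := top_le_iff.1 (ha ▸ hb)
    rw [hD.1.Phi_sq_mul_eq_zero γ (ha.trans hb.symm),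
      hD.1.Phi_sq_mul_eq_zero γ ((h ▸ ha).trans hb.symm)]
  | coe i =>
    have playsWell : Phi γ (bar (D.get i) * b) ^ 2 = Phi γ (D.get i * b) ^ 2 :=
      hD.playsWell_of_le_levelOf (ha ▸ hb)
    rcases (hD.1.levelOf_eq_coe_iff a i).1 ha with rfl | rfl <;>
      rcases (hD.1.levelOf_eq_coe_iff a' i).1 (h ▸ ha) with rfl | rfl <;>
      simp only [playsWell]

lemma IsHalf.sum_mirrorWeight_levelOf_eq_top (hD : IsHalf D) (β : Fin p → ℝ) :
    ∑ a with levelOf D a = ⊤, mirrorWeight β a.1 = 1 := by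
  have h := sum_Q_isMirror β
  rw [Finset.sum_congr rfl fun a ha => (Finset.mem_filter.1 ha).2.Q_eq β,
    ← Complex.ofReal_sum, Complex.ofReal_eq_one] at h
  simpa only [hD.levelOf_eq_top_iff] using h

/-- The configurations as a `PairedSystem`, whose pairs `{b, b̄}` are ordered by their index in
the admissible indexing `D`. -/
def configSystem (γ β : Fin p → ℝ) (D : List (Config p)) (hD : IsIndexing γ D) :
    PairedSystem (Config p) D.length where
  level := levelOf D
  P a b := Phi γ (a * b) ^ 2
  q := Q β
  wt a := mirrorWeight β a.1
  rep := D.get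
  opp i := bar (D.get i)
  P_comm a b := by rw [mul_comm]
  P_nonneg a b := sq_nonneg _
  P_eq_zero a b h := hD.1.Phi_sq_mul_eq_zero γ h
  P_congr a a' b h hb := hD.Phi_sq_mul_congr h hb
  rep_ne_opp i := (bar_ne_self (hD.1.2.1 _ (D.get_mem i))).symm
  level_eq_iff a i := hD.1.levelOf_eq_coe_iff a i
  q_opp i := Q_bar β (hD.1.2.1 _ (D.get_mem i))
  wt_nonneg a := mirrorWeight_nonneg β a.1
  q_eq a h := ((hD.1.levelOf_eq_top_iff a).1 h).Q_eq β
  sum_wt := hD.1.sum_mirrorWeight_levelOf_eq_top β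

variable (β : Fin p → ℝ)

lemma configSystem_damping (hD : IsIndexing γ D) (u : Config p) :
    (configSystem γ β D hD).damping u = F γ β u := by
  simp [PairedSystem.damping, F, configSystem, hD.1.levelOf_eq_top_iff]

lemma configSystem_coupling (hD : IsIndexing γ D) (i : Fin D.length) (u : Config p) :
    (configSystem γ β D hD).coupling i u = K γ β (D.get i) u := by
  rw [PairedSystem.coupling, configSystem_damping, K, X]
  simp [configSystem]

/-- The iteration for `R` stops before the first element of `D`, which plays well with all of `D`:
a last step with it would change nothing. -/
lemma IsIndexing.foldl_sweepStep_get (hD : IsIndexing γ D) (i : Fin D.length) :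
    D.reverse.foldl (sweepStep (K γ β)) (fun _ => 1) (D.get i) = R γ β D (D.get i) := by
  have R_eq : R γ β D = D.tail.reverse.foldl (sweepStep (K γ β)) (fun _ => 1) := rfl
  rw [R_eq]
  cases D with
  | nil => exact i.elim0
  | cons a L =>
    have K_head : K γ β a ((a :: L).get i) = 0 :=
      (hD.playsWell_get (i := ⟨0, by simp⟩) (Fin.mk_le_of_le_val (by simp))).K_eq_zero β
    rw [List.reverse_cons, List.foldl_append, List.tail_cons, List.foldl_cons, List.foldl_nil,
      sweepStep, K_head]
    simp

lemma Y_eq_exp_sum (u : Config p) :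
    Y γ β D u = Complex.exp (∑ i, R γ β D (D.get i) * K γ β (D.get i) u) := by
  rw [Y, ← List.sum_ofFn]
  congr 2
  exact List.ext_getElem (by simp) (by simp)

theorem tendsto_bulkSum_configSystem (hD : IsIndexing γ D) (c : Config p → ℕ) :
    Tendsto (fun n => (configSystem γ β D hD).bulkSum n c) atTop
      (𝓝 (∏ u, (F γ β u * Y γ β D u) ^ c u)) := by
  have limit := (configSystem γ β D hD).tendsto_bulkSum c
  have rep : ∀ j, (configSystem γ β D hD).rep j = D.get j := fun _ => rfl
  have series := (hasSum_layerTerm (d := D.get) (k := K γ β)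
    (fun i j hij => (hD.playsWell_get hij).K_eq_zero β)
    (fun _ => 1) (fun i => ∑ u, c u * K γ β (D.get i) u)).tsum_eq
  rw [List.ofFn_get] at series
  simp only [configSystem_damping, configSystem_coupling, rep, series,
    hD.foldl_sweepStep_get β] at limit
  convert limit using 2
  simp only [mul_pow, Finset.prod_mul_distrib, Y_eq_exp_sum, ← Complex.exp_nat_mul,
    ← Complex.exp_sum, Finset.mul_sum]
  rw [Finset.sum_comm]
  congr 2
  exact Finset.sum_congr rfl fun i _ => Finset.sum_congr rfl fun u _ => by ring

/-- The summand `weight γ β n N` without its multinomial coefficient. -/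
def amplitude (γ β : Fin p → ℝ) (n : ℕ) (N : Config p → ℕ) : ℂ :=
  ((Real.exp (-(1 / (4 * n)) * ∑ a, ∑ b, Phi γ (a * b) ^ 2 * N a * N b) : ℝ) : ℂ) *
    ∏ a, Q β a ^ N a

/-- The moment `∏_{u ∈ L} n_u / n` of the occupation numbers `n_a = N_a + c_a`, of which only the
`N_a` are counted by a multinomial coefficient. -/
def momentSum (γ β : Fin p → ℝ) (n : ℕ) (L : List (Config p)) (c : Config p → ℕ) : ℂ :=
  ∑ N ∈ Finset.univ.piAntidiag (n - ∑ a, c a), (Nat.multinomial Finset.univ N : ℂ) *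
    ((L.map fun u => (((N + c) u : ℕ) : ℂ) / n).prod * amplitude γ β n (N + c))

lemma momentSum_nil (hD : IsIndexing γ D) (n : ℕ) (c : Config p → ℕ) :
    momentSum γ β n [] c = (∏ a, Q β a ^ c a) * (configSystem γ β D hD).bulkSum n c := by
  rw [momentSum, PairedSystem.bulkSum, Finset.mul_sum]
  refine Finset.sum_congr rfl fun N _ => ?_
  simp only [amplitude, Pi.add_apply, pow_add, Finset.prod_mul_distrib, List.map_nil,
    List.prod_nil, one_mul, PairedSystem.quad, configSystem]
  ring

/-- A factor `N_u` takes one element out of the class `u` and adds it to the fixed part `c`. -/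
lemma momentSum_cons {n : ℕ} (u : Config p) (L : List (Config p)) (c : Config p → ℕ)
    (hn : ∑ a, c a < n) :
    momentSum γ β n (u :: L) c =
      ((n - ∑ a, c a : ℕ) : ℂ) / n * momentSum γ β n L (c + Pi.single u 1) +
        c u / n * momentSum γ β n L c := by
  obtain ⟨k, hk⟩ : ∃ k, n - ∑ a, c a = k + 1 := ⟨n - ∑ a, c a - 1, by omega⟩
  have remaining : n - ∑ a, (c + Pi.single u 1 : Config p → ℕ) a = k := by
    simp only [Pi.add_apply, Finset.sum_add_distrib, Finset.sum_pi_single', Finset.mem_univ,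
      if_true]
    omega
  have absorb := sum_multinomial_mul_apply k u fun N : Config p → ℕ =>
    (L.map fun u => (((N + c) u : ℕ) : ℂ) / n).prod * amplitude γ β n (N + c)
  simp only [add_right_comm _ (Pi.single u 1) c, add_assoc] at absorb
  unfold momentSum
  rw [remaining, hk, Nat.cast_add_one, div_mul_eq_mul_div, ← absorb, Finset.sum_div,
    Finset.mul_sum, ← Finset.sum_add_distrib]
  refine Finset.sum_congr rfl fun N _ => ?_
  simp only [List.map_cons, List.prod_cons, Pi.add_apply, Nat.cast_add]
  ring

theorem tendsto_momentSum (hD : IsIndexing γ D) (L : List (Config p)) (c : Config p → ℕ) :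
    Tendsto (fun n => momentSum γ β n L c) atTop
      (𝓝 ((L.map (W γ β D)).prod * ∏ a, W γ β D a ^ c a)) := by
  induction L generalizing c with
  | nil =>
    have h := (tendsto_bulkSum_configSystem β hD c).const_mul (∏ a, Q β a ^ c a)
    simp only [momentSum_nil β hD]
    convert h using 2
    simp only [List.map_nil, List.prod_nil, one_mul, ← Finset.prod_mul_distrib, ← mul_pow, W, X,
      mul_assoc]
  | cons u L ih =>
    have absorbed := (tendsto_natCast_sub_div (∑ a, c a)).mul (ih (c + Pi.single u 1))
    have negligible := (tendsto_const_div_atTop_nhds_zero_nat (c u : ℂ)).mul (ih c)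
    have limit := absorbed.add negligible
    have prod_add_single : ∏ a, W γ β D a ^ (c + Pi.single u 1 : Config p → ℕ) a =
        (∏ a, W γ β D a ^ c a) * W γ β D u := by
      simp only [Pi.add_apply, pow_add, Finset.prod_mul_distrib]
      simp [Pi.single_apply, pow_ite]
    rw [zero_mul, add_zero, one_mul, prod_add_single] at limit
    rw [List.map_cons, List.prod_cons, mul_comm (W γ β D u), mul_assoc, mul_comm (W γ β D u)]
    refine limit.congr' ?_
    filter_upwards [eventually_gt_atTop (∑ a, c a)] with n hn
    rw [momentSum_cons β u L c hn]

lemma tendsto_momentSum_zero (hD : IsIndexing γ D) (L : List (Config p)) :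
    Tendsto (fun n => ∑ N ∈ Finset.univ.piAntidiag n,
      weight γ β n N * (L.map fun u => (N u : ℂ) / n).prod) atTop
      (𝓝 (L.map (W γ β D)).prod) := by
  have h := tendsto_momentSum β hD L 0
  simp only [Pi.zero_apply, pow_zero, Finset.prod_const_one, mul_one] at h
  refine h.congr fun n => ?_
  simp only [momentSum, amplitude, weight, add_zero, Pi.zero_apply, Finset.sum_const_zero,
    Nat.sub_zero]
  exact Finset.sum_congr rfl fun N _ => by ring

theorem tendsto_S₂ (hD : IsIndexing γ D) (u v : Config p) :
    Tendsto (S₂ γ β u v) atTop (𝓝 (W γ β D u * W γ β D v)) := by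
  have h := tendsto_momentSum_zero β hD [u, v]
  simp only [List.map_cons, List.map_nil, List.prod_cons, List.prod_nil, mul_one] at h
  exact h.congr fun n => Finset.sum_congr rfl fun N _ => by ring

theorem tendsto_S₄ (hD : IsIndexing γ D) (u v x y : Config p) :
    Tendsto (S₄ γ β u v x y) atTop
      (𝓝 (W γ β D u * W γ β D v * W γ β D x * W γ β D y)) := by
  have h := tendsto_momentSum_zero β hD [u, v, x, y]
  simp only [List.map_cons, List.map_nil, List.prod_cons, List.prod_nil, mul_one, ← mul_assoc] at h
  exact h.congr fun n => Finset.sum_congr rfl fun N _ => by ring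

end ConfigurationLimits

/-! ### The unitaries of the QAOA -/

section Unitaries

lemma pow_eq_of_mul_self_eq_one {𝔸 : Type*} [Ring 𝔸] [Algebra ℂ 𝔸] {x : 𝔸} (hx : x * x = 1)
    (k : ℕ) :
    x ^ k = (1 / 2 : ℂ) • (1 + x) + (-1 : ℂ) ^ k • (1 / 2 : ℂ) • (1 - x) := by
  induction k with
  | zero => simp only [pow_zero]; module
  | succ k ih =>
    rw [pow_succ, ih, add_mul, smul_mul_assoc, smul_mul_assoc, smul_mul_assoc, add_mul, sub_mul,
      hx, one_mul, pow_succ]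
    module

lemma exp_smul_of_mul_self_eq_one {𝔸 : Type*} [NormedRing 𝔸] [NormedAlgebra ℂ 𝔸]
    [CompleteSpace 𝔸] {x : 𝔸} (hx : x * x = 1) (z : ℂ) :
    NormedSpace.exp (z • x) = Complex.cosh z • 1 + Complex.sinh z • x := by
  have series_exp : ∀ w : ℂ, HasSum (fun k : ℕ => w ^ k / (k.factorial : ℂ)) (Complex.exp w) :=
    fun w => by
      rw [Complex.exp_eq_exp_ℂ]
      exact NormedSpace.expSeries_div_hasSum_exp w
  have series_split := ((series_exp z).smul_const ((1 / 2 : ℂ) • (1 + x))).add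
    ((series_exp (-z)).smul_const ((1 / 2 : ℂ) • (1 - x)))
  have series : HasSum (fun k : ℕ => ((k.factorial : ℂ)⁻¹) • (z • x) ^ k)
      (NormedSpace.exp (z • x)) := NormedSpace.exp_series_hasSum_exp' (𝕂 := ℂ) (z • x)
  have term_eq : ∀ k : ℕ, ((k.factorial : ℂ)⁻¹) • (z • x) ^ k =
      (z ^ k / (k.factorial : ℂ)) • (1 / 2 : ℂ) • (1 + x) +
        ((-z) ^ k / (k.factorial : ℂ)) • (1 / 2 : ℂ) • (1 - x) := by
    intro k
    rw [smul_pow, pow_eq_of_mul_self_eq_one hx, neg_pow z]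
    module
  simp only [term_eq] at series
  rw [series.unique series_split, Complex.cosh, Complex.sinh]
  module

variable {n : ℕ}

/-- The amplitude `⟨z|e^{-iβX}|z'⟩` of one spin, as a function of the product `z z'`. -/
def mixerAmp (β : ℝ) (b : ℤˣ) : ℂ :=
  if b = 1 then (Real.cos β : ℂ) else -(Complex.I * Real.sin β)

lemma mulSingle_neg_one_mul_self (j : Fin n) :
    (Pi.mulSingle j (-1) * Pi.mulSingle j (-1) : Spins n) = 1 := by
  rw [← Pi.mulSingle_mul, Int.units_mul_self, Pi.mulSingle_one]

lemma update_neg_eq_mul_mulSingle (z : Spins n) (j : Fin n) :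
    Function.update z j (-z j) = z * Pi.mulSingle j (-1) := by
  funext k
  rcases eq_or_ne k j with rfl | h
  · simp
  · simp [h]

lemma pauliX_apply (j : Fin n) (z z' : Spins n) :
    pauliX j z z' = if z' = z * Pi.mulSingle j (-1) then 1 else 0 := by
  rw [pauliX, update_neg_eq_mul_mulSingle]
  congr 1
  refine propext ⟨fun h => ?_, fun h => ?_⟩ <;>
    rw [h, mul_assoc, mulSingle_neg_one_mul_self, mul_one]

lemma pauliX_mul_apply (j : Fin n) (M : Matrix (Spins n) (Spins n) ℂ) (z z' : Spins n) :
    (pauliX j * M) z z' = M (z * Pi.mulSingle j (-1)) z' := by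
  simp [Matrix.mul_apply, pauliX_apply]

lemma pauliX_mul_self (j : Fin n) : pauliX j * pauliX j = 1 := by
  ext z z'
  rw [pauliX_mul_apply, pauliX_apply, mul_assoc, mulSingle_neg_one_mul_self, mul_one,
    Matrix.one_apply]
  simp only [eq_comm]

lemma commute_pauliX (i j : Fin n) : Commute (pauliX i) (pauliX j) := by
  rw [Commute, SemiconjBy]
  ext z z'
  rw [pauliX_mul_apply, pauliX_mul_apply, pauliX_apply, pauliX_apply, mul_right_comm]

lemma exp_smul_pauliX (β : ℝ) (j : Fin n) :
    NormedSpace.exp ((-(Complex.I * (β : ℂ))) • pauliX j) =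
      (Real.cos β : ℂ) • (1 : Matrix (Spins n) (Spins n) ℂ) +
        (-(Complex.I * Real.sin β)) • pauliX j := by
  have h : NormedSpace.exp ((-(Complex.I * (β : ℂ))) • pauliX j) =
      Complex.cosh (-(Complex.I * (β : ℂ))) • (1 : Matrix (Spins n) (Spins n) ℂ) +
        Complex.sinh (-(Complex.I * (β : ℂ))) • pauliX j :=
    open scoped Matrix.Norms.Operator in
      exp_smul_of_mul_self_eq_one (pauliX_mul_self j) _
  rw [h, Complex.cosh_neg, Complex.sinh_neg, mul_comm Complex.I, Complex.cosh_mul_I,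
    Complex.sinh_mul_I, Complex.ofReal_cos, Complex.ofReal_sin, mul_comm Complex.I]

lemma exp_smul_pauliX_mul_apply (β : ℝ) (j : Fin n) (M : Matrix (Spins n) (Spins n) ℂ)
    (z z' : Spins n) :
    (NormedSpace.exp ((-(Complex.I * (β : ℂ))) • pauliX j) * M) z z' =
      ∑ b, mixerAmp β b * M (z * Pi.mulSingle j b) z' := by
  rw [exp_smul_pauliX, add_mul, smul_mul_assoc, smul_mul_assoc, one_mul, Matrix.add_apply,
    Matrix.smul_apply, Matrix.smul_apply, pauliX_mul_apply, UnitsInt.univ,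
    Finset.sum_pair (by decide)]
  simp [mixerAmp]

lemma forall_notMem_mul_mulSingle_iff {s : Finset (Fin n)} {i : Fin n} (hi : i ∉ s) (b : ℤˣ)
    (z z' : Spins n) :
    (∀ j, j ∉ s → (z * Pi.mulSingle i b : Spins n) j = z' j) ↔
      b = z i * z' i ∧ ∀ j, j ∉ insert i s → z j = z' j := by
  have at_i : (z * Pi.mulSingle i b : Spins n) i = z' i ↔ b = z i * z' i := by
    rw [Pi.mul_apply, Pi.mulSingle_eq_same, ← eq_inv_mul_iff_mul_eq, Int.units_inv_eq_self]
  have off_i : ∀ j, j ≠ i → (z * Pi.mulSingle i b : Spins n) j = z j := fun j hj => by simp [hj]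
  simp only [Finset.mem_insert, not_or, ← at_i]
  refine ⟨fun h => ⟨h i hi, fun j hj => off_i j hj.1 ▸ h j hj.2⟩, fun h j hj => ?_⟩
  rcases eq_or_ne j i with rfl | hji
  · exact h.1
  · exact (off_i j hji).trans (h.2 j ⟨hji, hj⟩)

lemma exp_smul_sum_pauliX_apply (β : ℝ) (s : Finset (Fin n)) (z z' : Spins n) :
    NormedSpace.exp ((-(Complex.I * (β : ℂ))) • ∑ j ∈ s, pauliX j) z z' =
      if ∀ j, j ∉ s → z j = z' j then ∏ j ∈ s, mixerAmp β (z j * z' j) else 0 := by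
  induction s using Finset.induction_on generalizing z with
  | empty => simp [Matrix.one_apply, funext_iff]
  | insert i s hi ih =>
    have commute : Commute ((-(Complex.I * (β : ℂ))) • pauliX i)
        ((-(Complex.I * (β : ℂ))) • ∑ j ∈ s, pauliX j) :=
      ((Commute.sum_right _ _ _ fun j _ => commute_pauliX i j).smul_left _).smul_right _
    have prod_congr : ∀ b, ∏ j ∈ s, mixerAmp β ((z * Pi.mulSingle i b : Spins n) j * z' j) =
        ∏ j ∈ s, mixerAmp β (z j * z' j) := fun b =>
      Finset.prod_congr rfl fun j hj => by simp [ne_of_mem_of_not_mem hj hi]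
    rw [Finset.sum_insert hi, smul_add, Matrix.exp_add_of_commute _ _ commute,
      exp_smul_pauliX_mul_apply]
    simp only [ih, forall_notMem_mul_mulSingle_iff hi, prod_congr, ite_and, mul_ite, mul_zero,
      Finset.sum_ite_eq', Finset.mem_univ, if_true, Finset.prod_insert hi]

lemma mixerUnitary_apply (β : ℝ) (z z' : Spins n) :
    mixerUnitary n β z z' = ∏ j, mixerAmp β (z j * z' j) := by
  rw [mixerUnitary, mixer, exp_smul_sum_pauliX_apply]
  simp

lemma phaseUnitary_eq (J : Pairs n → ℝ) (γ : ℝ) :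
    phaseUnitary J γ =
      Matrix.diagonal fun z => Complex.exp (-(Complex.I * (γ : ℂ)) * cost J z) := by
  rw [phaseUnitary, costOp, ← Matrix.diagonal_smul, Matrix.exp_diagonal]
  congr 1
  funext z
  rw [Pi.coe_exp, ← Complex.exp_eq_exp_ℂ]
  rfl

end Unitaries

/-! ### The energy as a sum over paths -/

section Paths

variable {n p : ℕ}

/-- The state at time `r` of the path that ends in `z` and is multiplied by the flips `b s` at the
times `s`. -/
def pathPoint (z : Spins n) (b : Fin p → Spins n) (r : Fin p) : Spins n :=
  z * ∏ s ∈ Finset.Ici r, b s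

lemma pathPoint_snoc_castSucc (z : Spins n) (b : Fin p → Spins n) (w : Spins n) (r : Fin p) :
    pathPoint z (Fin.snoc (α := fun _ => Spins n) b w) r.castSucc = pathPoint (z * w) b r := by
  have prod_Ici : ∀ {q : ℕ} (r : Fin q) (f : Fin q → Spins n),
      ∏ s ∈ Finset.Ici r, f s = ∏ s, if r ≤ s then f s else 1 := fun r f => by
    rw [← Finset.prod_filter, Finset.filter_le_eq_Ici]
  rw [pathPoint, pathPoint, prod_Ici, prod_Ici, Fin.prod_univ_castSucc, mul_assoc]
  simp [Fin.le_last, mul_comm w]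

lemma pathPoint_snoc_last (z : Spins n) (b : Fin p → Spins n) (w : Spins n) :
    pathPoint z (Fin.snoc (α := fun _ => Spins n) b w) (Fin.last p) = z * w := by
  have Ici_last : Finset.Ici (Fin.last p) = {Fin.last p} := by
    ext s
    simp [Fin.last_le_iff]
  rw [pathPoint, Ici_last, Finset.prod_singleton, Fin.snoc_last]

/-- The amplitude with which the flips `b` contribute to the state of the QAOA at `z`. -/
def pathAmplitude (J : Pairs n → ℝ) (γ β : Fin p → ℝ) (z : Spins n) (b : Fin p → Spins n) : ℂ :=
  (∏ r, ∏ j, mixerAmp (β r) (b r j)) *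
    Complex.exp (-(Complex.I * ((∑ r, γ r * cost J (pathPoint z b r) : ℝ) : ℂ)))

lemma pathAmplitude_snoc (J : Pairs n → ℝ) (γ β : Fin (p + 1) → ℝ) (z : Spins n)
    (b : Fin p → Spins n) (w : Spins n) :
    pathAmplitude J γ β z (Fin.snoc (α := fun _ => Spins n) b w) =
      (∏ j, mixerAmp (β (Fin.last p)) (w j)) *
        (Complex.exp (-(Complex.I * (γ (Fin.last p) : ℂ)) * cost J (z * w)) *
          pathAmplitude J (fun r => γ r.castSucc) (fun r => β r.castSucc) (z * w) b) := by
  simp only [pathAmplitude, Fin.prod_univ_castSucc, Fin.sum_univ_castSucc, Fin.snoc_castSucc,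
    Fin.snoc_last, pathPoint_snoc_castSucc, pathPoint_snoc_last, Complex.ofReal_add,
    Complex.ofReal_mul, mul_add, neg_add, Complex.exp_add, ← mul_assoc, neg_mul]
  ring

lemma qaoaState_succ (J : Pairs n → ℝ) (γ β : Fin (p + 1) → ℝ) :
    qaoaState J γ β = mixerUnitary n (β (Fin.last p)) *ᵥ (phaseUnitary J (γ (Fin.last p)) *ᵥ
      qaoaState J (fun r => γ r.castSucc) (fun r => β r.castSucc)) := by
  unfold qaoaState
  rw [List.finRange_succ_last, List.foldl_append, List.foldl_map]
  rfl

lemma qaoaState_apply (J : Pairs n → ℝ) (γ β : Fin p → ℝ) (z : Spins n) :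
    qaoaState J γ β z = ((1 / Real.sqrt (2 ^ n) : ℝ) : ℂ) * ∑ b, pathAmplitude J γ β z b := by
  induction p generalizing z with
  | zero => simp [qaoaState, initialState, pathAmplitude]
  | succ p ih =>
    rw [qaoaState_succ, phaseUnitary_eq, Matrix.mulVec, dotProduct]
    simp only [mixerUnitary_apply, Matrix.mulVec_diagonal, ih]
    rw [← (Fin.snocEquiv fun _ => Spins n).sum_comp, Fintype.sum_prod_type, Finset.mul_sum,
      ← Equiv.sum_comp (Equiv.mulLeft z)]
    refine Finset.sum_congr rfl fun w _ => ?_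
    have step_eq : ∀ j, z j * (z * w) j = w j := fun j => by
      rw [Pi.mul_apply, ← mul_assoc, Int.units_mul_self, one_mul]
    simp only [Equiv.coe_mulLeft, step_eq, Fin.snocEquiv, Equiv.coe_fn_mk, Finset.mul_sum]
    refine Finset.sum_congr rfl fun b _ => ?_
    rw [pathAmplitude_snoc]
    ring

lemma star_mixerAmp_mul_mixerAmp (β : ℝ) (b c : ℤˣ) :
    star (mixerAmp β b) * mixerAmp β c = qFactor (Real.cos β) (Real.sin β) b c := by
  have neg_one_ne : (-1 : ℤˣ) ≠ 1 := by decide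
  rcases Int.units_eq_one_or b with rfl | rfl <;> rcases Int.units_eq_one_or c with rfl | rfl <;>
    simp [mixerAmp, qFactor, theta, neg_one_ne, -Complex.ofReal_cos, -Complex.ofReal_sin] <;>
    ring_nf
  rw [Complex.I_sq, neg_one_mul, neg_neg]

lemma star_prod_mixerAmp_mul (β : Fin p → ℝ) (a : Fin n → Config p) :
    star (∏ r, ∏ j, mixerAmp (β r) ((a j).1 r)) * ∏ r, ∏ j, mixerAmp (β r) ((a j).2 r) =
      ∏ j, Q β (a j) := by
  simp only [star_prod, ← Finset.prod_mul_distrib, star_mixerAmp_mul_mixerAmp, Q_eq_prod_qFactor]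
  exact Finset.prod_comm

/-- The coefficient of `J_e` in `C(z)`. -/
def costCoeff (z : Spins n) (e : Pairs n) : ℝ :=
  ((z e.1.1 : ℤ) : ℝ) * ((z e.1.2 : ℤ) : ℝ) / Real.sqrt n

lemma cost_eq_sum_costCoeff (J : Pairs n → ℝ) (z : Spins n) :
    cost J z = ∑ e, costCoeff z e * J e := by
  rw [cost, Finset.mul_sum]
  exact Finset.sum_congr rfl fun e _ => by rw [costCoeff]; ring

lemma costCoeff_mul_self (z : Spins n) (e : Pairs n) : costCoeff z e * costCoeff z e = 1 / n := by
  have cast_mul_self : ∀ x : ℤˣ, ((x : ℤ) : ℝ) * ((x : ℤ) : ℝ) = 1 := fun x => by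
    rw [← Int.cast_mul, ← Units.val_mul, Int.units_mul_self, Units.val_one, Int.cast_one]
  rw [costCoeff, div_mul_div_comm, Real.mul_self_sqrt n.cast_nonneg, mul_mul_mul_comm,
    cast_mul_self, cast_mul_self, one_mul]

lemma sum_cost_pathPoint_sub (γ : Fin p → ℝ) (J : Pairs n → ℝ) (z : Spins n)
    (a : Fin n → Config p) :
    ∑ r, γ r * cost J (pathPoint z (fun r j => (a j).1 r) r) -
      ∑ r, γ r * cost J (pathPoint z (fun r j => (a j).2 r) r) =
    ∑ e, costCoeff z e * Phi γ (a e.1.1 * a e.1.2) * J e := by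
  simp only [cost_eq_sum_costCoeff, costCoeff, Phi, Finset.mul_sum, Finset.sum_mul,
    ← Finset.sum_sub_distrib]
  rw [Finset.sum_comm]
  refine Finset.sum_congr rfl fun e _ => Finset.sum_congr rfl fun r _ => ?_
  simp only [pathPoint, starDiff, Prod.fst_mul, Prod.snd_mul, starOp_mul, Pi.mul_apply,
    Finset.prod_apply]
  simp only [starOp]
  push_cast
  ring

lemma star_pathAmplitude_mul (J : Pairs n → ℝ) (γ β : Fin p → ℝ) (z : Spins n)
    (a : Fin n → Config p) :
    star (pathAmplitude J γ β z fun r j => (a j).1 r) *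
        pathAmplitude J γ β z (fun r j => (a j).2 r) =
      (∏ j, Q β (a j)) * Complex.exp (Complex.I *
        ∑ e, ((costCoeff z e * Phi γ (a e.1.1 * a e.1.2) : ℝ) : ℂ) * J e) := by
  have phase_eq := congrArg Complex.ofReal (sum_cost_pathPoint_sub γ J z a)
  simp only [Complex.ofReal_sub, Complex.ofReal_sum (s := (Finset.univ : Finset (Pairs n))),
    Complex.ofReal_mul _ (J _)] at phase_eq
  rw [pathAmplitude, pathAmplitude, star_mul', mul_mul_mul_comm, star_prod_mixerAmp_mul,
    Complex.star_def, ← Complex.exp_conj, ← Complex.exp_add, ← phase_eq]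
  congr 2
  simp only [map_neg, map_mul, Complex.conj_I, Complex.conj_ofReal]
  ring

/-- A path for the ket and a path for the bra are together one configuration for each spin. -/
lemma energyDensity_eq (γ β : Fin p → ℝ) (J : Pairs n → ℝ) :
    energyDensity γ β J = (1 / 2 ^ n : ℂ) * ∑ z : Spins n, ∑ a : Fin n → Config p,
      (∏ j, Q β (a j)) * (1 / (n : ℂ) * (cost J z * Complex.exp (Complex.I *
        ∑ e, ((costCoeff z e * Phi γ (a e.1.1 * a e.1.2) : ℝ) : ℂ) * J e))) := by
  have normalization :
      ((1 / Real.sqrt (2 ^ n) : ℝ) : ℂ) * ((1 / Real.sqrt (2 ^ n) : ℝ) : ℂ) = 1 / 2 ^ n := by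
    rw [← Complex.ofReal_mul, div_mul_div_comm, Real.mul_self_sqrt (by positivity)]
    push_cast
    ring
  have sum_configs : ∀ z, star (∑ b, pathAmplitude J γ β z b) * ∑ b, pathAmplitude J γ β z b =
      ∑ a : Fin n → Config p, (∏ j, Q β (a j)) * Complex.exp (Complex.I *
        ∑ e, ((costCoeff z e * Phi γ (a e.1.1 * a e.1.2) : ℝ) : ℂ) * J e) := by
    intro z
    simp only [← star_pathAmplitude_mul]
    rw [star_sum, Finset.sum_mul_sum, ← Fintype.sum_prod_type', eq_comm]
    exact ((Equiv.arrowProdEquivProdArrow (Fin n) _ _).trans ((Equiv.piComm _).prodCongr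
      (Equiv.piComm _))).sum_comp fun b : (Fin p → Spins n) × (Fin p → Spins n) =>
        star (pathAmplitude J γ β z b.1) * pathAmplitude J γ β z b.2
  rw [energyDensity, dotProduct, Finset.mul_sum]
  refine Finset.sum_congr rfl fun z _ => ?_
  rw [Matrix.smul_mulVec, costOp, Pi.smul_apply, Matrix.mulVec_diagonal, Pi.star_apply,
    qaoaState_apply, star_mul', Complex.star_def, Complex.conj_ofReal, smul_eq_mul]
  calc _ = (((1 / Real.sqrt (2 ^ n) : ℝ) : ℂ) * ((1 / Real.sqrt (2 ^ n) : ℝ) : ℂ)) *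
        (1 / (n : ℂ) * cost J z * (star (∑ b, pathAmplitude J γ β z b) *
          ∑ b, pathAmplitude J γ β z b)) := by rw [Complex.star_def]; ring
    _ = _ := by
      rw [normalization, sum_configs, Finset.mul_sum]
      congr 1
      exact Finset.sum_congr rfl fun a _ => by ring

end Paths

/-! ### The energy averaged over the couplings -/

section Average

variable {n p : ℕ}

lemma integrable_cost_mul_exp (z : Spins n) (τ : Pairs n → ℝ) :
    Integrable (fun J : Pairs n → ℝ => (cost J z : ℂ) *
      Complex.exp (Complex.I * ∑ e, (τ e : ℂ) * J e)) (couplingLaw n) := by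
  simp only [cost_eq_sum_costCoeff]
  exact integrable_sum_mul_exp_pi_gaussianReal (fun _ => 1) (costCoeff z) τ

lemma integrable_energyDensity (γ β : Fin p → ℝ) :
    Integrable (energyDensity (n := n) γ β) (couplingLaw n) := by
  rw [funext (energyDensity_eq γ β)]
  exact (integrable_finsetSum _ fun z _ => integrable_finsetSum _ fun a _ =>
    ((integrable_cost_mul_exp z _).const_mul _).const_mul _).const_mul _

lemma sum_sum_eq_two_nsmul_sum_pairs {M : Type*} [AddCommMonoid M] (f : Fin n → Fin n → M)
    (hsymm : ∀ j k, f j k = f k j) (hdiag : ∀ j, f j j = 0) :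
    ∑ j, ∑ k, f j k = 2 • ∑ e : Pairs n, f e.1.1 e.1.2 := by
  have sum_pairs_eq : ∑ e : Pairs n, f e.1.1 e.1.2 = ∑ j, ∑ k, if j < k then f j k else 0 := by
    rw [← Fintype.sum_prod_type' (f := fun j k => if j < k then f j k else 0),
      ← Finset.sum_filter]
    exact (Finset.sum_subtype (p := fun e : Fin n × Fin n => e.1 < e.2) _ (by simp)
      (fun e => f e.1 e.2)).symm
  rw [two_nsmul, sum_pairs_eq]
  nth_rw 3 [Finset.sum_comm]
  simp only [← Finset.sum_add_distrib]
  refine Finset.sum_congr rfl fun j _ => Finset.sum_congr rfl fun k _ => ?_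
  rcases lt_trichotomy j k with h | h | h
  · simp [h, h.not_gt]
  · simp [h, hdiag]
  · simp [h, h.not_gt, hsymm j k]

lemma sum_pairs_comp {A : Type*} [Fintype A] [DecidableEq A] (f : A → A → ℝ)
    (hsymm : ∀ b c, f b c = f c b) (hdiag : ∀ b, f b b = 0) (a : Fin n → A) :
    ∑ e : Pairs n, f (a e.1.1) (a e.1.2) =
      1 / 2 * ∑ b, ∑ c, f b c * valueCount a b * valueCount a c := by
  have sum_all : ∑ j, ∑ k, f (a j) (a k) =
      ∑ b, ∑ c, f b c * valueCount a b * valueCount a c := by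
    rw [sum_comp_eq_sum_valueCount_mul a fun b => ∑ k, f b (a k)]
    refine Finset.sum_congr rfl fun b _ => ?_
    rw [sum_comp_eq_sum_valueCount_mul a fun c => f b c, Finset.mul_sum]
    exact Finset.sum_congr rfl fun c _ => by ring
  rw [← sum_all, sum_sum_eq_two_nsmul_sum_pairs (fun j k => f (a j) (a k))
    (fun j k => hsymm _ _) fun j => hdiag _, nsmul_eq_mul]
  push_cast
  ring

lemma integral_cost_mul_exp (γ : Fin p → ℝ) (z : Spins n) (a : Fin n → Config p) :
    ∫ J : Pairs n → ℝ, (cost J z : ℂ) * Complex.exp (Complex.I *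
        ∑ e, ((costCoeff z e * Phi γ (a e.1.1 * a e.1.2) : ℝ) : ℂ) * J e) ∂(couplingLaw n) =
      Complex.I *
        ((1 / (2 * n) * ∑ u, ∑ v, Phi γ (u * v) * valueCount a u * valueCount a v : ℝ) : ℂ) *
        (Real.exp (-(1 / (4 * n)) *
          ∑ u, ∑ v, Phi γ (u * v) ^ 2 * valueCount a u * valueCount a v) : ℝ) := by
  have sum_Phi := sum_pairs_comp (fun u v => Phi γ (u * v)) (fun u v => by rw [mul_comm])
    (Phi_mul_self γ) a
  have sum_Phi_sq := sum_pairs_comp (fun u v => Phi γ (u * v) ^ 2) (fun u v => by rw [mul_comm])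
    (fun u => by rw [Phi_mul_self, zero_pow two_ne_zero]) a
  have covariance : ∑ e : Pairs n, costCoeff z e * (costCoeff z e * Phi γ (a e.1.1 * a e.1.2)) =
      1 / (2 * n) * ∑ u, ∑ v, Phi γ (u * v) * valueCount a u * valueCount a v := by
    simp only [← mul_assoc, costCoeff_mul_self]
    rw [← Finset.mul_sum, sum_Phi]
    ring
  have variance : -(∑ e : Pairs n, (costCoeff z e * Phi γ (a e.1.1 * a e.1.2)) ^ 2) / 2 =
      -(1 / (4 * n)) * ∑ u, ∑ v, Phi γ (u * v) ^ 2 * valueCount a u * valueCount a v := by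
    simp only [mul_pow, pow_two (costCoeff _ _), costCoeff_mul_self]
    rw [← Finset.mul_sum, sum_Phi_sq]
    ring
  simp only [cost_eq_sum_costCoeff]
  rw [couplingLaw, integral_sum_mul_exp_pi_gaussianReal (fun _ => 1)]
  simp only [NNReal.coe_one, one_mul, covariance, variance]

/-- The integrand depends on the spins `z` only through a gauge transformation of the couplings,
and its mean on `a` only through the occupation numbers. -/
lemma integral_energyDensity (γ β : Fin p → ℝ) :
    ∫ J, energyDensity (n := n) γ β J ∂(couplingLaw n) =
      Complex.I / 2 * ∑ u, ∑ v, (Phi γ (u * v) : ℂ) * S₂ γ β u v n := by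
  have integrable_term : ∀ (z : Spins n) (a : Fin n → Config p), Integrable (fun J : Pairs n → ℝ =>
      (∏ j, Q β (a j)) * (1 / (n : ℂ) * (cost J z * Complex.exp (Complex.I *
        ∑ e, ((costCoeff z e * Phi γ (a e.1.1 * a e.1.2) : ℝ) : ℂ) * J e)))) (couplingLaw n) :=
    fun z a => ((integrable_cost_mul_exp z _).const_mul _).const_mul _
  have integral_term : ∀ (z : Spins n) (a : Fin n → Config p), ∫ J : Pairs n → ℝ,
      (∏ j, Q β (a j)) * (1 / (n : ℂ) * (cost J z * Complex.exp (Complex.I *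
        ∑ e, ((costCoeff z e * Phi γ (a e.1.1 * a e.1.2) : ℝ) : ℂ) * J e))) ∂(couplingLaw n) =
      amplitude γ β n (valueCount a) * (Complex.I / (2 * n ^ 2) *
        ∑ u, ∑ v, (Phi γ (u * v) : ℂ) * valueCount a u * valueCount a v) := fun z a => by
    rw [integral_const_mul, integral_const_mul, integral_cost_mul_exp,
      prod_comp_eq_prod_pow_valueCount a (Q β), amplitude]
    push_cast
    ring
  have card_spins : (1 / 2 ^ n : ℂ) * (Fintype.card (Spins n) : ℂ) = 1 := by
    simp [Fintype.card_units_int]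
  rw [funext (energyDensity_eq γ β), integral_const_mul, integral_finsetSum _ fun z _ =>
    integrable_finsetSum _ fun a _ => integrable_term z a]
  simp only [fun z => integral_finsetSum (μ := couplingLaw n) Finset.univ
    fun a _ => integrable_term z a, integral_term]
  rw [Finset.sum_const, Finset.card_univ, nsmul_eq_mul, ← mul_assoc, card_spins, one_mul,
    sum_comp_valueCount fun N => amplitude γ β n N * (Complex.I / (2 * n ^ 2) *
      ∑ u, ∑ v, (Phi γ (u * v) : ℂ) * N u * N v)]
  simp only [S₂, Finset.mul_sum, Fintype.card_fin]
  rw [Finset.sum_congr rfl fun u _ => Finset.sum_comm, Finset.sum_comm]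
  refine Finset.sum_congr rfl fun N _ => ?_
  rw [nsmul_eq_mul]
  simp only [Finset.mul_sum]
  refine Finset.sum_congr rfl fun u _ => Finset.sum_congr rfl fun v _ => ?_
  rw [weight, amplitude]
  ring

lemma sum_sum_starDiff_mul (w : Config p → ℂ) (r : Fin p) :
    ∑ u, ∑ v, (starDiff (u * v) r : ℂ) * (w u * w v) =
      (∑ u, (starSum u r : ℂ) * w u) * ∑ v, (starDiff v r : ℂ) * w v := by
  have starDiff_mul : ∀ u v : Config p, (starDiff (u * v) r : ℂ) =
      ((starSum u r : ℂ) * starDiff v r + starDiff u r * starSum v r) / 2 := fun u v => by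
    simp only [starDiff, starSum, starOp_mul, Prod.fst_mul, Prod.snd_mul, Pi.mul_apply]
    push_cast
    ring
  have sum_diff_mul_sum := mul_comm (∑ u, (starDiff u r : ℂ) * w u) (∑ v, (starSum v r : ℂ) * w v)
  calc ∑ u, ∑ v, (starDiff (u * v) r : ℂ) * (w u * w v)
      = ((∑ u, (starSum u r : ℂ) * w u) * (∑ v, (starDiff v r : ℂ) * w v) +
          (∑ u, (starDiff u r : ℂ) * w u) * ∑ v, (starSum v r : ℂ) * w v) / 2 := by
        simp only [Finset.sum_mul_sum, ← Finset.sum_add_distrib, Finset.sum_div, starDiff_mul]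
        exact Finset.sum_congr rfl fun u _ => Finset.sum_congr rfl fun v _ => by ring
    _ = _ := by rw [sum_diff_mul_sum, add_self_div_two]

lemma V_eq (γ β : Fin p → ℝ) (D : List (Config p)) :
    V γ β D = Complex.I / 2 *
      ∑ u, ∑ v, (Phi γ (u * v) : ℂ) * (W γ β D u * W γ β D v) := by
  simp only [V, mul_assoc, ← sum_sum_starDiff_mul]
  simp only [Phi, Complex.ofReal_sum, Finset.sum_mul]
  congr 1
  rw [Finset.sum_congr rfl fun u _ => Finset.sum_comm, Finset.sum_comm]
  refine Finset.sum_congr rfl fun r _ => ?_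
  simp only [Finset.mul_sum]
  refine Finset.sum_congr rfl fun u _ => Finset.sum_congr rfl fun v _ => ?_
  push_cast
  ring

lemma tendsto_integral_energyDensity {γ : Fin p → ℝ} (β : Fin p → ℝ) {D : List (Config p)}
    (hD : IsIndexing γ D) :
    Tendsto (fun n : ℕ => ∫ J, energyDensity (n := n) γ β J ∂(couplingLaw n)) atTop
      (𝓝 (V γ β D)) := by
  simp only [integral_energyDensity, V_eq]
  exact (tendsto_finsetSum _ fun u _ => tendsto_finsetSum _ fun v _ =>
    (tendsto_S₂ β hD u v).const_mul _).const_mul _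

end Average

/-! ### The number of operations of the procedure -/

section OperationCount

open Instr Reg

variable {p : ℕ}

lemma card_config (p : ℕ) : Fintype.card (Config p) = 4 ^ p := by
  simp [← mul_pow]

lemma length_allConfigs (p : ℕ) : (allConfigs p).length = 4 ^ p := by
  rw [allConfigs, Finset.length_toList, Finset.card_univ, card_config]

lemma length_symmConfigs_le (p : ℕ) : (symmConfigs p).length ≤ 4 ^ p :=
  (List.length_filter_le _ _).trans (length_allConfigs p).le

lemma length_progTrig (p : ℕ) : (progTrig p).length = p * 2 := by
  simp [progTrig, List.length_flatMap]

lemma length_progFactor_le (r : Fin p) (b : ℤˣ) (conj : Bool) :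
    (progFactor r b conj).length ≤ 4 := by
  unfold progFactor
  split_ifs <;> simp

lemma length_progQ_le (p : ℕ) : (progQ p).length ≤ 4 ^ p * (p * 8 + 2) := by
  have length_factors_le : ∀ a : Config p, ((List.finRange p).flatMap fun r =>
      progFactor r (a.1 r) false ++ progFactor r (a.2 r) true).length ≤ p * 8 := fun a => by
    rw [List.length_flatMap]
    refine (List.sum_le_card_nsmul _ 8 ?_).trans_eq (by simp)
    simp only [List.mem_map, List.length_append]
    rintro _ ⟨r, -, rfl⟩
    exact add_le_add (length_progFactor_le r (a.1 r) false) (length_progFactor_le r (a.2 r) true)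
  rw [progQ, List.length_flatMap]
  refine (List.sum_le_card_nsmul _ (p * 8 + 2) ?_).trans_eq (by simp [length_allConfigs])
  simp only [List.mem_map, List.length_append, List.length_singleton]
  rintro _ ⟨a, -, rfl⟩
  linarith [length_factors_le a]

lemma length_progPhi (p : ℕ) : (progPhi p).length = 4 ^ p * (p * 3 + 2) := by
  simp +arith [progPhi, List.length_flatMap, length_allConfigs]

lemma length_progX (p : ℕ) :
    (progX p).length = 4 ^ p * ((symmConfigs p).length * 2 + 5) := by
  simp +arith [progX, List.length_flatMap, length_allConfigs]

lemma length_progR (D : List (Config p)) :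
    (progR D).length = D.length + (D.length - 1) * (D.length * 7) := by
  simp [progR, progRK, List.length_flatMap]

lemma length_progW (D : List (Config p)) :
    (progW D).length = (symmConfigs p).length + D.length * (D.length * 6 + 4) := by
  simp +arith [progW, progRK, List.length_flatMap]

lemma length_progV (p : ℕ) : (progV p).length = p * (4 ^ p * 6 + 5) + 5 := by
  simp +arith [progV, List.length_flatMap, length_allConfigs]

lemma length_procedure_le (D : List (Config p)) (hD : D.Nodup) :
    (procedure D).length ≤ 64 * 16 ^ p := by
  have length_D : D.length ≤ 4 ^ p := card_config p ▸ hD.length_le_card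
  have length_tail_D : D.length - 1 ≤ 4 ^ p := (Nat.sub_le _ _).trans length_D
  have length_symm := length_symmConfigs_le p
  have p_le : p ≤ 4 ^ p := (Nat.lt_pow_self (by norm_num)).le
  have one_le : 1 ≤ 4 ^ p := Nat.one_le_pow _ _ (by norm_num)
  have sixteen_pow : 16 ^ p = 4 ^ p * 4 ^ p := by rw [← mul_pow]; norm_num
  have length_Q := length_progQ_le p
  simp only [procedure, List.length_append, length_progTrig, length_progPhi, length_progX,
    length_progR, length_progW, length_progV, sixteen_pow]
  generalize 4 ^ p = N at *
  calc _ ≤ N * 2 + N * (N * 8 + 2) + N * (N * 3 + 2) + N * (N * 2 + 5) +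
        (N + N * (N * 7)) + (N + N * (N * 6 + 4)) + (N * (N * 6 + 5) + 5) := by
        gcongr
        exact length_Q.trans (by gcongr)
    _ ≤ 64 * (N * N) := by nlinarith [Nat.mul_le_mul one_le one_le, Nat.mul_le_mul_right N one_le]

end OperationCount

/-! ### Straight-line programs -/

section Avoids

variable {ι : Type}

/-- The register that an instruction overwrites. -/
def Instr.dest : Instr ι → ι
  | .rat d _ => d
  | .imag d => d
  | .copy d _ => d
  | .neg d _ => d
  | .add d _ _ => d
  | .sub d _ _ => d
  | .mul d _ _ => d
  | .exp d _ => d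
  | .cos d _ => d
  | .sin d _ => d

/-- The program writes to no register of `S`, so that it preserves what is known about `S`. -/
def Avoids (S : Set ι) (prog : List (Instr ι)) : Prop := ∀ i ∈ prog, i.dest ∉ S

variable {S : Set ι} {α : Type*}

@[simp]
lemma avoids_nil : Avoids S [] := by simp [Avoids]

@[simp]
lemma avoids_cons {i : Instr ι} {prog : List (Instr ι)} :
    Avoids S (i :: prog) ↔ i.dest ∉ S ∧ Avoids S prog := List.forall_mem_cons

@[simp]
lemma avoids_append {prog prog' : List (Instr ι)} :
    Avoids S (prog ++ prog') ↔ Avoids S prog ∧ Avoids S prog' := List.forall_mem_append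

@[simp]
lemma avoids_flatMap {l : List α} {f : α → List (Instr ι)} :
    Avoids S (l.flatMap f) ↔ ∀ a ∈ l, Avoids S (f a) := by
  simp only [Avoids, List.mem_flatMap]
  exact ⟨fun h a ha i hi => h i ⟨a, ha, hi⟩, fun h i ⟨a, ha, hi⟩ => h a ha i hi⟩

end Avoids

section Exec

variable {ι : Type} [DecidableEq ι] {S : Set ι} {α : Type*}

@[simp]
lemma exec_nil (m : ι → ℂ) : exec [] m = m := rfl

@[simp]
lemma exec_cons (i : Instr ι) (prog : List (Instr ι)) (m : ι → ℂ) :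
    exec (i :: prog) m = exec prog (i.run m) := rfl

lemma exec_append (prog prog' : List (Instr ι)) (m : ι → ℂ) :
    exec (prog ++ prog') m = exec prog' (exec prog m) := List.foldl_append

lemma Instr.run_of_ne_dest {i : Instr ι} {x : ι} (h : x ≠ i.dest) (m : ι → ℂ) :
    i.run m x = m x := by
  cases i <;> exact Function.update_of_ne h _ _

lemma Avoids.exec_apply {prog : List (Instr ι)} (h : Avoids S prog) {x : ι} (hx : x ∈ S)
    (m : ι → ℂ) : exec prog m x = m x := by
  induction prog generalizing m with
  | nil => rfl
  | cons i prog ih =>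
    rw [avoids_cons] at h
    rw [exec_cons, ih h.2, Instr.run_of_ne_dest (ne_of_mem_of_not_mem hx h.1)]

lemma Avoids.eqOn {prog : List (Instr ι)} (h : Avoids S prog) {m spec : ι → ℂ}
    (hm : Set.EqOn m spec S) : Set.EqOn (exec prog m) spec S := fun x hx => by
  rw [h.exec_apply hx, hm hx]

variable {spec m : ι → ℂ} {l : List α} {f : α → List (Instr ι)} {c : ι}

lemma exec_flatMap_eq_foldl (op : ℂ → α → ℂ) (havoids : ∀ a ∈ l, Avoids S (f a))
    (hstep : ∀ a ∈ l, ∀ m, Set.EqOn m spec S → exec (f a) m c = op (m c) a)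
    (hm : Set.EqOn m spec S) : exec (l.flatMap f) m c = l.foldl op (m c) := by
  induction l generalizing m with
  | nil => rfl
  | cons a l ih =>
    rw [List.flatMap_cons, exec_append, ih (fun b hb => havoids b (List.mem_cons_of_mem _ hb))
      (fun b hb => hstep b (List.mem_cons_of_mem _ hb)) ((havoids a List.mem_cons_self).eqOn hm),
      hstep a List.mem_cons_self m hm, List.foldl_cons]

lemma exec_flatMap_eq_sum (g : α → ℂ) (havoids : ∀ a ∈ l, Avoids S (f a))
    (hstep : ∀ a ∈ l, ∀ m, Set.EqOn m spec S → exec (f a) m c = m c + g a)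
    (hm : Set.EqOn m spec S) (hc : m c = 0) : exec (l.flatMap f) m c = (l.map g).sum := by
  rw [exec_flatMap_eq_foldl (fun y a => y + g a) havoids hstep hm, hc, List.sum_eq_foldl,
    List.foldl_map]

lemma exec_flatMap_eq_prod (g : α → ℂ) (havoids : ∀ a ∈ l, Avoids S (f a))
    (hstep : ∀ a ∈ l, ∀ m, Set.EqOn m spec S → exec (f a) m c = m c * g a)
    (hm : Set.EqOn m spec S) (hc : m c = 1) : exec (l.flatMap f) m c = (l.map g).prod := by
  rw [exec_flatMap_eq_foldl (fun y a => y * g a) havoids hstep hm, hc, List.prod_eq_foldl,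
    List.foldl_map]

lemma eqOn_exec_flatMap (T : α → Set ι) (havoids : ∀ a ∈ l, Avoids S (f a))
    (hdisj : ∀ a ∈ l, ∀ b ∈ l, a ≠ b → Avoids (T b) (f a))
    (hval : ∀ a ∈ l, ∀ m, Set.EqOn m spec S → Set.EqOn (exec (f a) m) spec (T a))
    (hm : Set.EqOn m spec S) :
    Set.EqOn (exec (l.flatMap f) m) spec (S ∪ {x | ∃ a ∈ l, x ∈ T a}) := by
  induction l using List.reverseRecOn generalizing m with
  | nil => simpa using hm
  | append_singleton l a ih =>
    rw [List.flatMap_append, exec_append, List.flatMap_singleton]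
    have eqOn_before := ih (fun b hb => havoids b (by simp [hb]))
      (fun b hb c hc => hdisj b (by simp [hb]) c (by simp [hc]))
      (fun b hb => hval b (by simp [hb])) hm
    have eqOn_S := eqOn_before.mono Set.subset_union_left
    rintro x (hx | ⟨b, hb, hx⟩)
    · exact (havoids a (by simp)).eqOn eqOn_S hx
    · rcases eq_or_ne a b with rfl | hab
      · exact hval a (by simp) _ eqOn_S hx
      · have hbl : b ∈ l := by simpa [hab.symm] using hb
        exact (hdisj a (by simp) b hb hab).eqOn (fun y hy => eqOn_before (.inr ⟨b, hbl, hy⟩)) hx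

end Exec

/-! ### Correctness of the procedure -/

section Correctness

open Instr Reg

variable {p : ℕ}

/-- The final contents of the registers; the entries of the scratch registers are arbitrary. -/
def target (γ β : Fin p → ℝ) (D : List (Config p)) : Reg p → ℂ
  | .gamma k => γ k
  | .beta k => β k
  | .cosBeta k => Real.cos (β k)
  | .sinBeta k => Real.sin (β k)
  | .phiSq c => (Phi γ c : ℂ) ^ 2
  | .q a => Q β a
  | .x b => X γ β b
  | .r j => R γ β D j
  | .w u => W γ β D u
  | .v => V γ β D
  | .tmp => 0
  | .acc => 0
  | .acc' => 0

/-- The phase of the procedure in which a register gets its final value, where `0` stands for the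
input and `8` for the registers without a final value. -/
def stage (D : List (Config p)) : Reg p → ℕ
  | .gamma _ => 0
  | .beta _ => 0
  | .cosBeta _ => 1
  | .sinBeta _ => 1
  | .q _ => 2
  | .phiSq _ => 3
  | .x _ => 4
  | .r j => if j ∈ D then 5 else 8
  | .w _ => 6
  | .v => 7
  | .tmp => 8
  | .acc => 8
  | .acc' => 8

/-- The registers that hold their final value after phase `k`. -/
def ready (D : List (Config p)) (k : ℕ) : Set (Reg p) := {y | stage D y ≤ k}

attribute [local simp] Instr.run Instr.dest stage target

@[simp]
lemma mem_ready {D : List (Config p)} {k : ℕ} {y : Reg p} : y ∈ ready D k ↔ stage D y ≤ k :=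
  Iff.rfl

lemma ready_mono (D : List (Config p)) : Monotone (ready D) := fun _ _ hkl _ hy => hy.trans hkl

lemma eqOn_ready_succ {D : List (Config p)} {k : ℕ} {m spec : Reg p → ℂ} {α : Type*} {l : List α}
    {f : α → List (Instr (Reg p))} (T : α → Set (Reg p))
    (havoids : ∀ a ∈ l, Avoids (ready D k) (f a))
    (hdisj : ∀ a ∈ l, ∀ b ∈ l, a ≠ b → Avoids (T b) (f a))
    (hval : ∀ a ∈ l, ∀ m, Set.EqOn m spec (ready D k) → Set.EqOn (exec (f a) m) spec (T a))
    (hT : ∀ y, stage D y = k + 1 → ∃ a ∈ l, y ∈ T a) (hm : Set.EqOn m spec (ready D k)) :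
    Set.EqOn (exec (l.flatMap f) m) spec (ready D (k + 1)) :=
  (eqOn_exec_flatMap T havoids hdisj hval hm).mono fun y hy =>
    (Nat.le_or_eq_of_le_succ hy).imp id (hT y)

lemma avoids_progFactor {S : Set (Reg p)} (hacc : acc ∉ S) (htmp : tmp ∉ S) (r : Fin p) (b : ℤˣ)
    (c : Bool) : Avoids S (progFactor r b c) := by
  unfold progFactor
  split_ifs <;> simp [hacc, htmp]

lemma exec_progFactor_pair (r : Fin p) (b c : ℤˣ) (m : Reg p → ℂ) :
    exec (progFactor r b false ++ progFactor r c true) m acc =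
      m acc * qFactor (m (cosBeta r)) (m (sinBeta r)) b c := by
  have neg_one_ne : (-1 : ℤˣ) ≠ 1 := by decide
  rcases Int.units_eq_one_or b with rfl | rfl <;> rcases Int.units_eq_one_or c with rfl | rfl <;>
    simp [progFactor, qFactor, theta, neg_one_ne] <;> ring_nf
  simp

lemma avoids_progRK {S : Set (Reg p)} (hacc' : acc' ∉ S) (htmp : tmp ∉ S) (b c : Config p) :
    Avoids S (progRK b c) := by
  simp [progRK, hacc', htmp]

variable (γ β : Fin p → ℝ) (D : List (Config p)) {m : Reg p → ℂ}

lemma exec_progRK (hm : Set.EqOn m (target γ β D) (ready D 4)) (b c : Config p) :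
    exec (progRK b c) m tmp = m (r b) * K γ β b c := by
  have phiSq_bar : m (phiSq (bar b * c)) = (Phi γ (bar b * c) : ℂ) ^ 2 := hm (by simp)
  have phiSq_eq : m (phiSq (b * c)) = (Phi γ (b * c) : ℂ) ^ 2 := hm (by simp)
  have x_eq : m (x b) = X γ β b := hm (by simp)
  rw [K, mul_assoc (1 / 2)]
  simp [progRK, phiSq_bar, phiSq_eq, x_eq]

lemma eqOn_progTrig (hm : Set.EqOn m (target γ β D) (ready D 0)) :
    Set.EqOn (exec (progTrig p) m) (target γ β D) (ready D 1) := by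
  refine eqOn_ready_succ (fun r => {cosBeta r, sinBeta r}) (by simp)
    (fun r _ s _ hrs => by simp [hrs]) ?_ ?_ hm
  · intro r _ m hm
    have beta_eq : m (beta r) = β r := hm (by simp)
    rintro y (rfl | rfl) <;> simp [beta_eq]
  · intro y hy
    cases y <;> simp [ite_eq_iff] at hy ⊢

lemma eqOn_progQ (hm : Set.EqOn m (target γ β D) (ready D 1)) :
    Set.EqOn (exec (progQ p) m) (target γ β D) (ready D 2) := by
  have avoids_factors : ∀ (a : Config p) (r : Fin p), Avoids (ready D 1)
      (progFactor r (a.1 r) false ++ progFactor r (a.2 r) true) := fun a r => by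
    simp [avoids_progFactor]
  refine eqOn_ready_succ (fun a => {q a}) (fun a _ => by simp [avoids_progFactor])
    (fun a _ b _ hab => by simp [hab, avoids_progFactor]) ?_ ?_ hm
  · rintro a - m hm _ rfl
    have acc_eq := exec_flatMap_eq_prod (l := List.finRange p) (c := acc)
      (fun j => qFactor (Real.cos (β j)) (Real.sin (β j)) (a.1 j) (a.2 j))
      (fun r _ => avoids_factors a r) (fun r _ m hm => by
        have cos_eq : m (cosBeta r) = Real.cos (β r) := hm (by simp)
        have sin_eq : m (sinBeta r) = Real.sin (β r) := hm (by simp)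
        rw [exec_progFactor_pair, cos_eq, sin_eq])
      (Avoids.eqOn (prog := [rat acc 1]) (by simp) hm) (by simp)
    rw [exec_append, exec_append, exec_cons, exec_nil, Instr.run, Function.update_self, acc_eq,
      target, Q_eq_prod_qFactor, Fin.prod_univ_def]
  · intro y hy
    cases y <;> simp [mem_allConfigs, ite_eq_iff, -Prod.exists] at hy ⊢

lemma eqOn_progPhi (hm : Set.EqOn m (target γ β D) (ready D 2)) :
    Set.EqOn (exec (progPhi p) m) (target γ β D) (ready D 3) := by
  refine eqOn_ready_succ (fun c => {phiSq c}) (by simp) (fun c _ d _ hcd => by simp [hcd]) ?_ ?_ hm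
  · rintro c - m hm _ rfl
    have acc_eq := exec_flatMap_eq_sum (l := List.finRange p) (c := acc)
      (f := fun r => [rat tmp (starDiff c r), mul tmp (gamma r) tmp, add acc acc tmp])
      (fun r => (γ r : ℂ) * starDiff c r) (S := ready D 2) (spec := target γ β D) (by simp)
      (fun r _ m hm => by
        have gamma_eq : m (gamma r) = γ r := hm (by simp)
        simp [gamma_eq])
      (Avoids.eqOn (prog := [rat acc 0]) (by simp) hm) (by simp)
    rw [exec_append, exec_append, exec_cons, exec_nil, Instr.run, Function.update_self, acc_eq,
      ← Fin.sum_univ_def]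
    simp [Phi, pow_two]
  · intro y hy
    cases y <;> simp [mem_allConfigs, ite_eq_iff, -Prod.exists] at hy ⊢

lemma mem_symmConfigs {a : Config p} : a ∈ symmConfigs p ↔ IsMirror a := by
  simp [symmConfigs, mem_allConfigs]

lemma sum_map_symmConfigs (f : Config p → ℂ) :
    ((symmConfigs p).map f).sum = ∑ a : Config p with IsMirror a, f a := by
  rw [symmConfigs, allConfigs, ← List.sum_toFinset f ((Finset.nodup_toList _).filter _)]
  exact Finset.sum_congr (by ext a; simp) fun _ _ => rfl

lemma eqOn_progX (hm : Set.EqOn m (target γ β D) (ready D 3)) :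
    Set.EqOn (exec (progX p) m) (target γ β D) (ready D 4) := by
  refine eqOn_ready_succ (fun b => {x b}) (by simp) (fun b _ c _ hbc => by simp [hbc]) ?_ ?_ hm
  · rintro b - m hm _ rfl
    let addTerm : Config p → List (Instr (Reg p)) := fun a =>
      [mul tmp (q a) (phiSq (a * b)), add acc acc tmp]
    have avoids_addTerm : ∀ a, Avoids (ready D 3) (addTerm a) := by simp [addTerm]
    have hm₀ := Avoids.eqOn (prog := [rat acc 0]) (by simp) hm
    have acc_eq := exec_flatMap_eq_sum (l := symmConfigs p) (c := acc)
      (fun a => Q β a * (Phi γ (a * b) : ℂ) ^ 2) (fun a _ => avoids_addTerm a)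
      (fun a _ m hm => by
        have q_eq : m (q a) = Q β a := hm (by simp)
        have phiSq_eq : m (phiSq (a * b)) = (Phi γ (a * b) : ℂ) ^ 2 := hm (by simp)
        simp [addTerm, q_eq, phiSq_eq]) hm₀ (by simp)
    have q_eq : exec ((symmConfigs p).flatMap addTerm) _ (q b) = Q β b :=
      (avoids_flatMap.2 fun a _ => avoids_addTerm a).eqOn hm₀ (by simp)
    rw [sum_map_symmConfigs] at acc_eq
    rw [exec_append, exec_append]
    generalize exec ((symmConfigs p).flatMap addTerm) _ = m' at acc_eq q_eq
    simp [acc_eq, q_eq, X, F, neg_div]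
  · intro y hy
    cases y <;> simp [mem_allConfigs, ite_eq_iff, -Prod.exists] at hy ⊢

/-- The update `R_j := R_j exp(R_s K_{s,j})`. -/
def progUpdate (s j : Config p) : List (Instr (Reg p)) :=
  progRK s j ++ [exp tmp tmp, mul (r j) (r j) tmp]

lemma avoids_progUpdate (s j : Config p) : Avoids (ready D 4) (progUpdate s j) := by
  by_cases hj : j ∈ D <;> simp [progUpdate, avoids_progRK, hj]

lemma exec_progUpdate_r (hm : Set.EqOn m (target γ β D) (ready D 4)) (s j k : Config p) :
    exec (progUpdate s j) m (r k) =
      if k = j then sweepStep (K γ β) (fun i => m (r i)) s j else m (r k) := by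
  have exec_progRK_r : ∀ i, exec (progRK s j) m (r i) = m (r i) := fun i =>
    (avoids_progRK (S := Set.range r) (by simp) (by simp) s j).exec_apply ⟨i, rfl⟩ m
  rw [progUpdate, exec_append]
  rcases eq_or_ne k j with rfl | hkj
  · simp [sweepStep, exec_progRK γ β D hm, exec_progRK_r]
  · simp [hkj, exec_progRK_r]

/-- The updates are made in place. Since `K_{s,s} = 0`, the source `R_s` keeps its value, so they
amount to a simultaneous update. -/
lemma exec_sweep (s : Config p) {l : List (Config p)} (hl : l.Nodup)
    (hm : Set.EqOn m (target γ β D) (ready D 4)) (k : Config p) :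
    exec (l.flatMap (progUpdate s)) m (r k) =
      if k ∈ l then sweepStep (K γ β) (fun i => m (r i)) s k else m (r k) := by
  have K_self : K γ β s s = 0 := by simp [K, Phi_mul_self, Phi_bar_mul_self]
  induction l generalizing m with
  | nil => simp
  | cons j l ih =>
    obtain ⟨hj, hl⟩ := List.nodup_cons.1 hl
    have source_eq : exec (progUpdate s j) m (r s) = m (r s) := by
      rw [exec_progUpdate_r γ β D hm]
      split_ifs with hsj
      · simp [sweepStep, ← hsj, K_self]
      · rfl
    rw [List.flatMap_cons, exec_append, ih hl ((avoids_progUpdate D s j).eqOn hm), sweepStep,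
      source_eq, exec_progUpdate_r γ β D hm]
    rcases eq_or_ne k j with rfl | hkj
    · simp [hj]
    · simp [hkj, sweepStep]

lemma exec_sweeps (hD : D.Nodup) {L : List (Config p)} (hL : ∀ s ∈ L, s ∈ D) {ρ : Config p → ℂ}
    (hm : Set.EqOn m (target γ β D) (ready D 4)) (hρ : ∀ j ∈ D, m (r j) = ρ j) {j : Config p}
    (hj : j ∈ D) :
    exec (L.flatMap fun s => D.flatMap (progUpdate s)) m (r j) =
      L.foldl (sweepStep (K γ β)) ρ j := by
  induction L generalizing m ρ with
  | nil => exact hρ j hj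
  | cons s L ih =>
    obtain ⟨hs, hL⟩ := List.forall_mem_cons.1 hL
    rw [List.flatMap_cons, exec_append, List.foldl_cons]
    refine ih hL ((avoids_flatMap.2 fun k _ => avoids_progUpdate D s k).eqOn hm) fun k hk => ?_
    rw [exec_sweep γ β D s hD hm, if_pos hk, sweepStep, hρ k hk, hρ s hs, sweepStep]

lemma exec_map_rat_r {l : List (Config p)} {j : Config p} (hj : j ∈ l) :
    exec (l.map fun k => rat (r k) 1) m (r j) = 1 := by
  have := eqOn_exec_flatMap (S := ∅) (m := m) (spec := fun _ => 1) (l := l)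
    (f := fun k => [rat (r k) 1]) (fun k => {r k}) (by simp) (fun k _ i _ hki => by simp [hki])
    (by simp) (by simp)
  rw [List.map_eq_flatMap]
  exact this (.inr ⟨j, hj, rfl⟩)

lemma eqOn_progR (hD : D.Nodup) (hm : Set.EqOn m (target γ β D) (ready D 4)) :
    Set.EqOn (exec (progR D) m) (target γ β D) (ready D 5) := by
  change Set.EqOn (exec (D.map (fun j => rat (r j) 1) ++
    D.tail.reverse.flatMap fun s => D.flatMap (progUpdate s)) m) _ _
  have eqOn_ready : Set.EqOn (exec (D.map fun j => rat (r j) 1) m) (target γ β D) (ready D 4) :=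
    Avoids.eqOn (by simp +contextual [List.map_eq_flatMap]) hm
  rw [exec_append]
  intro y hy
  rcases Nat.le_or_eq_of_le_succ hy with hy | hy
  · refine Avoids.eqOn ?_ eqOn_ready hy
    simp [avoids_progUpdate]
  · obtain ⟨j, rfl, hj⟩ : ∃ j, y = r j ∧ j ∈ D := by
      cases y <;> simp_all
    exact exec_sweeps γ β D hD (fun s hs => List.mem_of_mem_tail (List.mem_reverse.1 hs)) eqOn_ready
      (fun k hk => exec_map_rat_r hk) hj

/-- The program for `∑_{j ∈ D} R_j K_{j,u}`, the exponent of `Y_u`. -/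
def progExponent (D : List (Config p)) (u : Config p) : List (Instr (Reg p)) :=
  [rat acc 0] ++ D.flatMap fun j => progRK j u ++ [add acc acc tmp]

lemma avoids_progExponent {S : Set (Reg p)} (hacc : acc ∉ S) (hacc' : acc' ∉ S) (htmp : tmp ∉ S)
    (u : Config p) : Avoids S (progExponent D u) := by
  simp [progExponent, avoids_progRK, hacc, hacc', htmp]

lemma exec_progExponent (hm : Set.EqOn m (target γ β D) (ready D 5)) (u : Config p) :
    exec (progExponent D u) m acc = (D.map fun j => R γ β D j * K γ β j u).sum := by
  rw [progExponent, exec_append]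
  refine exec_flatMap_eq_sum (S := ready D 5) (spec := target γ β D) _
    (fun j _ => by simp [avoids_progRK]) (fun j hj m hm => ?_) (Avoids.eqOn (by simp) hm) (by simp)
  have r_eq : m (r j) = R γ β D j := hm (by simp [hj])
  have acc_eq : exec (progRK j u) m acc = m acc :=
    (avoids_progRK (S := {acc}) (by simp) (by simp) j u).exec_apply rfl m
  have tmp_eq := exec_progRK γ β D (hm.mono (ready_mono D (by norm_num))) j u
  simp [exec_append, acc_eq, tmp_eq, r_eq]

/-- The program for `W_u` and `W_ū` with `u ∈ D`. -/
def progPair (D : List (Config p)) (u : Config p) : List (Instr (Reg p)) :=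
  progExponent D u ++ [exp tmp acc, mul (w u) (x u) tmp, neg (w (bar u)) (w u)]

lemma eqOn_progPair (hm : Set.EqOn m (target γ β D) (ready D 5)) {u : Config p}
    (hu : ¬ IsMirror u) :
    Set.EqOn (exec (progPair D u) m) (target γ β D) {w u, w (bar u)} := by
  have acc_eq := exec_progExponent γ β D hm u
  have x_eq : exec (progExponent D u) m (x u) = X γ β u :=
    (avoids_progExponent D (by simp) (by simp) (by simp) u).eqOn hm (by simp)
  rintro y (rfl | rfl)
  · simp [progPair, exec_append, acc_eq, x_eq, W, Y, (bar_ne_self hu).symm]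
  · rw [target, W_bar γ β D hu]
    simp [progPair, exec_append, acc_eq, x_eq, W, Y]

lemma avoids_progPair {S : Set (Reg p)} (hacc : acc ∉ S) (hacc' : acc' ∉ S) (htmp : tmp ∉ S)
    {u : Config p} (hw : w u ∉ S) (hw_bar : w (bar u) ∉ S) : Avoids S (progPair D u) := by
  simp [progPair, avoids_progExponent, hacc, hacc', htmp, hw, hw_bar]

variable {D} in
lemma IsHalf.avoids_progPair_of_ne (hD : IsHalf D) {u u' : Config p} (hu : u ∈ D) (hu' : u' ∈ D)
    (hne : u ≠ u') : Avoids {w u', w (bar u')} (progPair D u) := by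
  have ne_bar : u ≠ bar u' := by
    rintro rfl
    exact (hD.2.2 u' (hD.2.1 u' hu')).1 hu' hu
  have bar_ne : bar u ≠ u' := by
    rintro rfl
    exact (hD.2.2 u (hD.2.1 u hu)).1 hu hu'
  have bar_ne_bar : bar u ≠ bar u' := fun h => hne (by rw [← bar_bar u, h, bar_bar])
  exact avoids_progPair D (by simp) (by simp) (by simp) (by simp [hne, ne_bar])
    (by simp [bar_ne, bar_ne_bar])

/-- The registers `w u` with `u` mirror symmetric. -/
def mirrorW (p : ℕ) : Set (Reg p) := w '' {u | IsMirror u}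

lemma eqOn_copyMirror (hm : Set.EqOn m (target γ β D) (ready D 5)) :
    Set.EqOn (exec ((symmConfigs p).map fun u => copy (w u) (x u)) m) (target γ β D)
      (ready D 5 ∪ mirrorW p) := by
  rw [List.map_eq_flatMap]
  refine (eqOn_exec_flatMap (fun u => {w u}) (by simp) (fun u _ v _ huv => by simp [huv]) ?_
    hm).mono (Set.union_subset_union_right _ ?_)
  · rintro u hu m hm _ rfl
    have x_eq : m (x u) = X γ β u := hm (by simp)
    simp [x_eq, (mem_symmConfigs.1 hu).W_eq]
  · rintro _ ⟨u, hu, rfl⟩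
    exact ⟨u, mem_symmConfigs.2 hu, rfl⟩

variable {D} in
lemma eqOn_progW (hD : IsHalf D) (hm : Set.EqOn m (target γ β D) (ready D 5)) :
    Set.EqOn (exec (progW D) m) (target γ β D) (ready D 6) := by
  change Set.EqOn (exec (((symmConfigs p).map fun u => copy (w u) (x u)) ++
    D.flatMap (progPair D)) m) _ _
  rw [exec_append]
  have mem_iff : ∀ u, w u ∈ ready D 5 ∪ mirrorW p ↔ IsMirror u := by
    simp [mirrorW]
  refine (eqOn_exec_flatMap (S := ready D 5 ∪ mirrorW p) (fun u => {w u, w (bar u)}) ?_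
    (fun u hu v hv => hD.avoids_progPair_of_ne hu hv)
    (fun u hu m hm => eqOn_progPair γ β D (hm.mono Set.subset_union_left) (hD.2.1 u hu))
    (eqOn_copyMirror γ β D hm)).mono ?_
  · intro u hu
    have not_mirror := hD.2.1 u hu
    exact avoids_progPair D (by simp [mirrorW]) (by simp [mirrorW]) (by simp [mirrorW])
      (by rwa [mem_iff]) (by rw [mem_iff]; exact not_isMirror_bar not_mirror)
  · intro y hy
    rcases Nat.le_or_eq_of_le_succ hy with hy | hy
    · exact .inl (.inl hy)
    obtain ⟨u, rfl⟩ : ∃ u, y = w u := by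
      cases y <;> simp_all [ite_eq_iff]
    by_cases hu : IsMirror u
    · exact .inl ((mem_iff u).2 hu)
    · by_cases huD : u ∈ D
      · exact .inr ⟨u, huD, .inl rfl⟩
      · exact .inr ⟨bar u, not_not.1 fun h => huD ((hD.2.2 u hu).2 h), by simp [bar_bar]⟩

/-- The program for the two sums of the `k`-th term of `V_p`. -/
def progSums (k : Fin p) : List (Instr (Reg p)) :=
  [rat acc 0, rat acc' 0] ++ (allConfigs p).flatMap fun u =>
    [rat tmp (starSum u k), mul tmp tmp (w u), add acc acc tmp,
      rat tmp (starDiff u k), mul tmp tmp (w u), add acc' acc' tmp]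

lemma avoids_progSums {S : Set (Reg p)} (hacc : acc ∉ S) (hacc' : acc' ∉ S) (htmp : tmp ∉ S)
    (k : Fin p) : Avoids S (progSums k) := by
  simp [progSums, hacc, hacc', htmp]

lemma exec_progSums_acc (hm : Set.EqOn m (target γ β D) (ready D 6)) (k : Fin p) :
    exec (progSums k) m acc = ∑ u, (starSum u k : ℂ) * W γ β D u := by
  rw [progSums, exec_append, ← Finset.sum_map_toList]
  refine exec_flatMap_eq_sum (S := ready D 6) (spec := target γ β D) _ (by simp)
    (fun u _ m hm => ?_) (Avoids.eqOn (by simp) hm) (by simp)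
  have w_eq : m (w u) = W γ β D u := hm (by simp)
  simp [w_eq]

lemma exec_progSums_acc' (hm : Set.EqOn m (target γ β D) (ready D 6)) (k : Fin p) :
    exec (progSums k) m acc' = ∑ u, (starDiff u k : ℂ) * W γ β D u := by
  rw [progSums, exec_append, ← Finset.sum_map_toList]
  refine exec_flatMap_eq_sum (S := ready D 6) (spec := target γ β D) _ (by simp)
    (fun u _ m hm => ?_) (Avoids.eqOn (by simp) hm) (by simp)
  have w_eq : m (w u) = W γ β D u := hm (by simp)
  simp [w_eq]

/-- The program that adds the `k`-th term of `V_p`, without the factor `i / 2`. -/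
def progTerm (k : Fin p) : List (Instr (Reg p)) :=
  progSums k ++ [mul tmp acc acc', mul tmp (gamma k) tmp, add v v tmp]

lemma avoids_progTerm (k : Fin p) : Avoids (ready D 6) (progTerm k) := by
  simp [progTerm, avoids_progSums]

lemma exec_progTerm_v (hm : Set.EqOn m (target γ β D) (ready D 6)) (k : Fin p) :
    exec (progTerm k) m v = m v + (γ k : ℂ) * ((∑ u, (starSum u k : ℂ) * W γ β D u) *
      (∑ u, (starDiff u k : ℂ) * W γ β D u)) := by
  have acc_eq := exec_progSums_acc γ β D hm k
  have acc'_eq := exec_progSums_acc' γ β D hm k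
  have gamma_eq : exec (progSums k) m (gamma k) = γ k :=
    (avoids_progSums (by simp) (by simp) (by simp) k).eqOn hm (by simp)
  have v_eq : exec (progSums k) m v = m v :=
    (avoids_progSums (S := {v}) (by simp) (by simp) (by simp) k).exec_apply rfl m
  simp [progTerm, exec_append, acc_eq, acc'_eq, gamma_eq, v_eq]

lemma exec_progV_v (hm : Set.EqOn m (target γ β D) (ready D 6)) :
    exec (progV p) m v = V γ β D := by
  have sum_eq := exec_flatMap_eq_sum (l := List.finRange p) (c := v) _
    (fun k _ => avoids_progTerm D k) (fun k _ m hm => exec_progTerm_v γ β D hm k)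
    (Avoids.eqOn (prog := [rat v 0]) (by simp) hm) (by simp)
  change exec ([rat v 0] ++ (List.finRange p).flatMap progTerm ++
    [rat tmp (1 / 2), mul v tmp v, imag tmp, mul v tmp v]) m v = _
  rw [exec_append, exec_append]
  generalize exec ((List.finRange p).flatMap progTerm) _ = m' at sum_eq
  simp only [V, mul_assoc, Fin.sum_univ_def, ← sum_eq]
  simp
  ring

lemma eqOn_progV (hm : Set.EqOn m (target γ β D) (ready D 6)) :
    Set.EqOn (exec (progV p) m) (target γ β D) (ready D 7) := by
  intro y hy
  rcases Nat.le_or_eq_of_le_succ hy with hy | hy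
  · exact Avoids.eqOn (by simp [progV]) hm hy
  · obtain rfl : y = v := by
      cases y <;> simp_all [ite_eq_iff]
    exact exec_progV_v γ β D hm

variable {D} in
lemma eqOn_procedure (hD : IsHalf D) (hγ : ∀ k, m (gamma k) = (γ k : ℂ))
    (hβ : ∀ k, m (beta k) = (β k : ℂ)) :
    Set.EqOn (exec (procedure D) m) (target γ β D) (ready D 7) := by
  have eqOn_input : Set.EqOn m (target γ β D) (ready D 0) := by
    intro y hy
    cases y <;> simp_all [ite_eq_iff]
  simp only [procedure, exec_append]
  exact eqOn_progV γ β D (eqOn_progW γ β hD (eqOn_progR γ β D hD.1 (eqOn_progX γ β D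
    (eqOn_progPhi γ β D (eqOn_progQ γ β D (eqOn_progTrig γ β D eqOn_input))))))

end Correctness

end QAOASK

end

theorem mainTheorem1 :
    -- the procedure takes at most `O(16^p)` elementary operations
    (∃ c : ℕ, ∀ (p : ℕ) (D : List (QAOASK.Config p)), QAOASK.IsHalf D →
      (QAOASK.procedure D).length ≤ c * 16 ^ p) ∧
    -- admissible indexings exist, independently of the parameters
    (∀ p : ℕ, ∃ D : List (QAOASK.Config p), ∀ γ : Fin p → ℝ, QAOASK.IsIndexing γ D) ∧
    ∀ (p : ℕ) (γ β : Fin p → ℝ) (D : List (QAOASK.Config p)), QAOASK.IsIndexing γ D →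
      -- the procedure computes the `W_u` and `V`
      (∀ m : QAOASK.Reg p → ℂ,
        (∀ r, m (.gamma r) = (γ r : ℂ)) → (∀ r, m (.beta r) = (β r : ℂ)) →
        (∀ u, QAOASK.exec (QAOASK.procedure D) m (.w u) = QAOASK.W γ β D u) ∧
        QAOASK.exec (QAOASK.procedure D) m .v = QAOASK.V γ β D) ∧
      -- the limits of the sums in the configuration basis
      (∀ u v : QAOASK.Config p, Filter.Tendsto (QAOASK.S₂ γ β u v) Filter.atTop
        (nhds (QAOASK.W γ β D u * QAOASK.W γ β D v))) ∧
      (∀ u v x y : QAOASK.Config p, Filter.Tendsto (QAOASK.S₄ γ β u v x y) Filter.atTop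
        (nhds (QAOASK.W γ β D u * QAOASK.W γ β D v * QAOASK.W γ β D x * QAOASK.W γ β D y))) ∧
      -- the limit of the expected energy density
      (∀ n : ℕ, MeasureTheory.Integrable (QAOASK.energyDensity (n := n) γ β)
        (QAOASK.couplingLaw n)) ∧
      Filter.Tendsto
        (fun n : ℕ => ∫ J, QAOASK.energyDensity (n := n) γ β J ∂(QAOASK.couplingLaw n))
        Filter.atTop (nhds (QAOASK.V γ β D)) := by
  refine ⟨⟨64, fun p D hD => QAOASK.length_procedure_le D hD.1⟩,
    fun p => ⟨QAOASK.pivotIndexing p, fun γ => QAOASK.isIndexing_pivotIndexing γ⟩,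
    fun p γ β D hD => ⟨fun m hγ hβ => ?_, fun u v => QAOASK.tendsto_S₂ β hD u v,
      fun u v x y => QAOASK.tendsto_S₄ β hD u v x y,
      fun n => QAOASK.integrable_energyDensity γ β, QAOASK.tendsto_integral_energyDensity β hD⟩⟩
  have exec_eq := QAOASK.eqOn_procedure γ β hD.1 hγ hβ
  exact ⟨fun u => exec_eq (x := .w u) (by simp [QAOASK.stage]),
    exec_eq (x := .v) (by simp [QAOASK.stage])⟩
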